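/- Let $\mathsf{TOF}$ be the strict symmetric monoidal category with objects the natural numbers generated by the ancillary bits $|1\rangle:0\to1$ and $\langle1|:1\to0$ and the Toffoli gate $\mathsf{tof}:3\to3$, subject to the following identities. Composition is written in diagrammatic order with $;$, wires are numbered from the top, and $\sigma$ is the crossing of two wires. Abbreviate $\mathsf{cnot}:=(|1\rangle\otimes1_2);\mathsf{tof};(\langle1|\otimes1_2)$, $\mathsf{not}:=(|1\rangle\otimes1_1);\mathsf{cnot};(\langle1|\otimes1_1)$, $|0\rangle:=|1\rangle;\mathsf{not}$, $\langle0|:=\mathsf{not};\langle1|$; write $[X\to z]$ for the gate $\mathsf{tof}$ ($|X|=2$) or $\mathsf{cnot}$ ($|X|=1$) with control wires $X$ (in increasing order, except that for a target above its controls the order of wires is reversed) and target wire $z$, obtained by conjugating with wire crossings. The seventeen identities are: 1. $(|1\rangle\otimes1_2);\mathsf{tof}=|1\rangle\otimes\mathsf{cnot}$ and $\mathsf{tof};(\langle1|\otimes1_2)=\langle1|\otimes\mathsf{cnot}$; 2. $(|0\rangle\otimes1_2);\mathsf{tof}=|0\rangle\otimes1_2$ and $\mathsf{tof};(\langle0|\otimes1_2)=\langle0|\otimes1_2$;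 3. $[12\to3]$ and $[45\to3]$ commute (5 wires); 4. $[23\to1]$ and $[34\to5]$ commute (5 wires); 5. $[23\to1]$ and $[23\to4]$ commute (4 wires); 6. $[13\to4]$ and $[23\to4]$ commute (4 wires); 7. $(1_2\otimes|1\rangle);[1\to3];(1_2\otimes\langle0|);(1_2\otimes|1\rangle);[2\to3];(1_2\otimes\langle0|)=(1_2\otimes|1\rangle);\mathsf{tof};(1_2\otimes\langle0|)$; 8. $(|1\rangle;\langle0|)\otimes1_1=(|1\rangle;\langle0|)\otimes(\langle1|;|1\rangle)$; 9. $|1\rangle;\langle1|=1_0$; 10. $\mathsf{tof};\mathsf{tof}=1_3$; 11. $[23\to4];[12\to3];[23\to4]=[12\to4];[12\to3]$; 12. $[1\to2];[23\to4];[1\to2]=[13\to4];[23\to4]$; 13. $[12\to3];[23\to4];[12\to3]=[12\to4];[23\to4]$; 14. $[12\to3];[3\to4];[12\to3]=[12\to4];[3\to4]$; 15. $[1\to2];[2\to1];[1\to2]=\sigma$; 16. $\mathsf{tof}=(\sigma\otimes1_1);\mathsf{tof};(\sigma\otimes1_1)$; 17. $t=(1_1\otimes\sigma\otimes1_1);t;(1_1\otimes\sigma\otimes1_1)$,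 where $t:=(1_2\otimes|0\rangle\otimes1_2);[12\to3];[34\to5];[12\to3];(1_2\otimes\langle0|\otimes1_2):4\to4$. Let $f^\circ$ be the map obtained by flipping a circuit horizontally (exchanging $|1\rangle$ and $\langle1|$), and call $f:n\to m$ total if $f;f^\circ=1_n$. The total maps $0\to n$ (total points of $n$) are exactly the $2^n$ distinct maps $|b_1,\dots,b_n\rangle=|b_1\rangle\otimes\cdots\otimes|b_n\rangle$ with $b\in\mathbb Z_2^n$. Let $\mathsf{FPinj}_2$ be the category with objects the sets $\mathbb Z_2^n$, $n\in\mathbb N$, and with all partial isomorphisms (partially defined injective functions) as maps, and let $\tilde H_0:\mathsf{TOF}\to\mathsf{FPinj}_2$ be the functor $n\mapsto\mathbb Z_2^n$ which evaluates maps on total points: for $f:n\to m$, $\tilde H_0(f)$ sends $b$ to $c$ if $|b\rangle;f=|c\rangle$, and is undefined at $b$ if $|b\rangle;f$ is not total. **Proposition.** The functor $\tilde H_0:\mathsf{TOF}\to\mathsf{FPinj}_2$ is full: for all $n,m$, every partial isomorphism $\mathbb Z_2^n\to\mathbb Z_2^m$ is $\tilde H_0(f)$ for some $f:n\to m$ in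 $\mathsf{TOF}$. Moreover, total functions are simulated, with extra outputs, by polynomial-form circuits. Let $\mathsf{cnot}_0:=\mathsf{not}$, $\mathsf{cnot}_1:=\mathsf{cnot}$, $\mathsf{cnot}_2:=\mathsf{tof}$ and, for $k\ge2$, $\mathsf{cnot}_{k+1}:=(1_2\otimes|0\rangle\otimes1_k);(\mathsf{tof}\otimes1_k);(1_2\otimes\mathsf{cnot}_k);(\mathsf{tof}\otimes1_k);(1_2\otimes\langle0|\otimes1_k)$; in $\mathsf{cnot}_k:k+1\to k+1$ the first $k$ wires are controls and the last is the target. A circuit $n+1\to n+1$ is in polynomial form if it is a composite of $\mathsf{cnot}_j$ gates ($j\ge0$), each with control wires among the first $n$ wires and target the last wire. Then for all $n,m$ and every function $f:\mathbb Z_2^n\to\mathbb Z_2^m$ there are circuits $q_1,\dots,q_m:n+1\to n+1$ in polynomial form such that $P_m:n\to n+m$, defined by $P_0=1_n$ and $P_{i+1}=(1_n\otimes|0\rangle);q_{i+1};(P_i\otimes1_1)$, satisfies $\tilde H_0(P_m)=\langle1,f\rangle$, that is, $\tilde H_0(P_m)(b)=(b,f(b))$ for all $b\in\mathbb Z_2^n$.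 -/

import Mathlib

namespace Toffoli

/-! ### Circuits over the Toffoli gate and the ancillary bits -/

/-- Terms of the free strict symmetric monoidal category (with objects the natural numbers) on the
generators `ketOne` (the input ancilla `|1⟩`), `braOne` (the output ancilla `⟨1|`) and the
Toffoli gate `tof`. Wires are listed from top to bottom, composition is diagrammatic. -/
inductive Circ : ℕ → ℕ → Type
  | id (n : ℕ) : Circ n n
  | comp {n m k : ℕ} (f : Circ n m) (g : Circ m k) : Circ n k
  | tensor {n m n' m' : ℕ} (f : Circ n m) (g : Circ n' m') : Circ (n + n') (m + m')
  | symm (n m : ℕ) : Circ (n + m) (m + n)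
  | ketOne : Circ 0 1
  | braOne : Circ 1 0
  | tof : Circ 3 3

notation:70 f:70 " ⨾ " g:71 => Circ.comp (f :) (g :)
notation:80 f:80 " ⊠ " g:81 => Circ.tensor (f :) (g :)

namespace Circ

/-- Transport of a circuit along equalities of the numbers of wires. -/
def cast {n m n' m' : ℕ} (hn : n = n') (hm : m = m') (f : Circ n m) : Circ n' m' :=
  hn ▸ hm ▸ f

/-- The horizontal flip of a circuit. -/
def dag : {n m : ℕ} → Circ n m → Circ m n
  | _, _, id n => id n
  | _, _, comp f g => comp (dag g) (dag f)
  | _, _, tensor f g => tensor (dag f) (dag g)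
  | _, _, symm n m => symm m n
  | _, _, ketOne => braOne
  | _, _, braOne => ketOne
  | _, _, tof => tof

/-- The crossing of two wires. -/
def swap : Circ 2 2 := symm 1 1

/-- The `cnot` gate (control on the first wire, target the second). -/
def cnot : Circ 2 2 := (ketOne ⊠ id 2) ⨾ tof ⨾ (braOne ⊠ id 2)

/-- The `not` gate. -/
def not : Circ 1 1 := (ketOne ⊠ id 1) ⨾ cnot ⨾ (braOne ⊠ id 1)

/-- The input ancilla `|0⟩`. -/
def ketZero : Circ 0 1 := ketOne ⨾ not

/-- The output ancilla `⟨0|`. -/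
def braZero : Circ 1 0 := not ⨾ braOne

/-- The permutation of three wires exchanging the first and the third. -/
def rev3 : Circ 3 3 := (swap ⊠ id 1) ⨾ (id 1 ⊠ swap) ⨾ (swap ⊠ id 1)

/-- The flipped Toffoli gate: target on the first wire, controls on the second and third. -/
def tofFlip : Circ 3 3 := rev3 ⨾ tof ⨾ rev3

/-- The flipped `cnot` gate: target on the first wire, control on the second. -/
def cnotFlip : Circ 2 2 := swap ⨾ cnot ⨾ swap

/-- The `cnot` gate with control on wire 1 and target wire 3, among three wires. -/
def cnot13 : Circ 3 3 := (id 1 ⊠ swap) ⨾ (cnot ⊠ id 1) ⨾ (id 1 ⊠ swap)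

/-- The Toffoli gate with controls on wires 1, 3 and target wire 4, among four wires. -/
def tof134 : Circ 4 4 := (swap ⊠ id 2) ⨾ (id 1 ⊠ tof) ⨾ (swap ⊠ id 2)

/-- The Toffoli gate with controls on wires 1, 2 and target wire 4, among four wires. -/
def tof124 : Circ 4 4 := (id 2 ⊠ swap) ⨾ (tof ⊠ id 1) ⨾ (id 2 ⊠ swap)

/-- The middle circuit of the last identity: a `not` gate controlled by three wires, made of three
Toffoli gates and a zero ancilla on the third of five wires. -/
def tripleControl : Circ 4 4 :=
  (id 2 ⊠ ketZero ⊠ id 2) ⨾ (tof ⊠ id 2) ⨾ (id 2 ⊠ tof) ⨾ (tof ⊠ id 2) ⨾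
    (id 2 ⊠ braZero ⊠ id 2)

/-- The congruence defining `TOF`: the laws of a strict symmetric monoidal category together
with the seventeen identities for the Toffoli gate and the ancillary bits. -/
inductive Rel : {n m : ℕ} → Circ n m → Circ n m → Prop
  -- equivalence relation and congruence
  | refl {n m : ℕ} (f : Circ n m) : Rel f f
  | symm {n m : ℕ} {f g : Circ n m} : Rel f g → Rel g f
  | trans {n m : ℕ} {f g h : Circ n m} : Rel f g → Rel g h → Rel f h
  | comp {n m k : ℕ} {f f' : Circ n m} {g g' : Circ m k} :
      Rel f f' → Rel g g' → Rel (f ⨾ g) (f' ⨾ g')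
  | tensor {n m n' m' : ℕ} {f f' : Circ n m} {g g' : Circ n' m'} :
      Rel f f' → Rel g g' → Rel (f ⊠ g) (f' ⊠ g')
  -- category laws
  | id_comp {n m : ℕ} (f : Circ n m) : Rel (id n ⨾ f) f
  | comp_id {n m : ℕ} (f : Circ n m) : Rel (f ⨾ id m) f
  | assoc {n m k l : ℕ} (f : Circ n m) (g : Circ m k) (h : Circ k l) :
      Rel (f ⨾ g ⨾ h) (f ⨾ (g ⨾ h))
  -- strict monoidal laws
  | tensor_id (n m : ℕ) : Rel (id n ⊠ id m) (id (n + m))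
  | interchange {n m k n' m' k' : ℕ} (f : Circ n m) (g : Circ m k)
      (f' : Circ n' m') (g' : Circ m' k') :
      Rel ((f ⨾ g) ⊠ (f' ⨾ g')) ((f ⊠ f') ⨾ (g ⊠ g'))
  | tensor_assoc {n m n' m' n'' m'' : ℕ} (f : Circ n m) (g : Circ n' m') (h : Circ n'' m'') :
      Rel (cast (Nat.add_assoc n n' n'') (Nat.add_assoc m m' m'') (f ⊠ g ⊠ h)) (f ⊠ (g ⊠ h))
  | tensor_unit {n m : ℕ} (f : Circ n m) : Rel (f ⊠ id 0) f
  | unit_tensor {n m : ℕ} (f : Circ n m) :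
      Rel (cast (Nat.zero_add n) (Nat.zero_add m) (id 0 ⊠ f)) f
  -- symmetry laws
  | symm_natural {n m n' m' : ℕ} (f : Circ n m) (g : Circ n' m') :
      Rel ((f ⊠ g) ⨾ Circ.symm m m') (Circ.symm n n' ⨾ (g ⊠ f))
  | symm_symm (n m : ℕ) : Rel (Circ.symm n m ⨾ Circ.symm m n) (id (n + m))
  | symm_unit (n : ℕ) : Rel (Circ.symm n 0) (cast rfl (Nat.zero_add n).symm (id n))
  | hexagon (n m k : ℕ) :
      Rel (Circ.symm n (m + k))
        (cast (Nat.add_assoc n m k) (Nat.add_assoc m n k) (Circ.symm n m ⊠ id k) ⨾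
          cast rfl (Nat.add_assoc m k n).symm (id m ⊠ Circ.symm n k))
  -- the seventeen identities
  | tof1 : Rel ((ketOne ⊠ id 2) ⨾ tof) (ketOne ⊠ cnot)
  | tof1_flip : Rel (tof ⨾ (braOne ⊠ id 2)) (braOne ⊠ cnot)
  | tof2 : Rel ((ketZero ⊠ id 2) ⨾ tof) (ketZero ⊠ id 2)
  | tof2_flip : Rel (tof ⨾ (braZero ⊠ id 2)) (braZero ⊠ id 2)
  | tof3 : Rel ((tof ⊠ id 2) ⨾ (id 2 ⊠ tofFlip)) ((id 2 ⊠ tofFlip) ⨾ (tof ⊠ id 2))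
  | tof4 : Rel ((tofFlip ⊠ id 2) ⨾ (id 2 ⊠ tof)) ((id 2 ⊠ tof) ⨾ (tofFlip ⊠ id 2))
  | tof5 : Rel ((tofFlip ⊠ id 1) ⨾ (id 1 ⊠ tof)) ((id 1 ⊠ tof) ⨾ (tofFlip ⊠ id 1))
  | tof5_5 : Rel (tof134 ⨾ (id 1 ⊠ tof)) ((id 1 ⊠ tof) ⨾ tof134)
  | tof6 : Rel
      ((id 2 ⊠ ketOne) ⨾ cnot13 ⨾ (id 2 ⊠ braZero) ⨾
        (id 2 ⊠ ketOne) ⨾ (id 1 ⊠ cnot) ⨾ (id 2 ⊠ braZero))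
      ((id 2 ⊠ ketOne) ⨾ tof ⨾ (id 2 ⊠ braZero))
  | tof7 : Rel ((ketOne ⨾ braZero) ⊠ id 1) ((ketOne ⨾ braZero) ⊠ (braOne ⨾ ketOne))
  | tof8 : Rel (ketOne ⨾ braOne) (id 0)
  | tof9 : Rel (tof ⨾ tof) (id 3)
  | tof10 : Rel ((id 1 ⊠ tof) ⨾ (tof ⊠ id 1) ⨾ (id 1 ⊠ tof)) (tof124 ⨾ (tof ⊠ id 1))
  | tof11 : Rel ((cnot ⊠ id 2) ⨾ (id 1 ⊠ tof) ⨾ (cnot ⊠ id 2)) (tof134 ⨾ (id 1 ⊠ tof))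
  | tof12 : Rel ((tof ⊠ id 1) ⨾ (id 1 ⊠ tof) ⨾ (tof ⊠ id 1)) (tof124 ⨾ (id 1 ⊠ tof))
  | tof13 : Rel ((tof ⊠ id 1) ⨾ (id 2 ⊠ cnot) ⨾ (tof ⊠ id 1)) (tof124 ⨾ (id 2 ⊠ cnot))
  | tof14 : Rel (cnot ⨾ cnotFlip ⨾ cnot) swap
  | tof15 : Rel tof ((swap ⊠ id 1) ⨾ tof ⨾ (swap ⊠ id 1))
  | tof16 : Rel tripleControl
      ((id 1 ⊠ swap ⊠ id 1) ⨾ tripleControl ⨾ (id 1 ⊠ swap ⊠ id 1))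

/-- Circuits modulo the defining congruence. -/
instance setoid (n m : ℕ) : Setoid (Circ n m) where
  r := Rel
  iseqv := ⟨Rel.refl, Rel.symm, Rel.trans⟩

end Circ

/-! ### The category `TOF` -/

/-- The objects of `TOF`: natural numbers (of wires). -/
structure TOF where
  wires : ℕ

/-- Maps of `TOF`: circuits modulo the defining congruence. -/
abbrev Mor (n m : ℕ) : Type := Quotient (Circ.setoid n m)

namespace Mor

/-- The map of `TOF` presented by a circuit. -/
def mk {n m : ℕ} (f : Circ n m) : Mor n m := Quotient.mk _ f

/-- Composition in `TOF`. -/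
def comp {n m k : ℕ} (f : Mor n m) (g : Mor m k) : Mor n k :=
  Quotient.map₂ Circ.comp (fun _ _ h _ _ h' => Circ.Rel.comp h h') f g

/-- The tensor product of `TOF`. -/
def tensor {n m n' m' : ℕ} (f : Mor n m) (g : Mor n' m') : Mor (n + n') (m + m') :=
  Quotient.map₂ Circ.tensor (fun _ _ h _ _ h' => Circ.Rel.tensor h h') f g

end Mor

open CategoryTheory

instance : Category TOF where
  Hom X Y := Mor X.wires Y.wires
  id X := Mor.mk (Circ.id X.wires)
  comp f g := Mor.comp f g
  id_comp := by rintro X Y ⟨f⟩; exact Quotient.sound (Circ.Rel.id_comp f)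
  comp_id := by rintro X Y ⟨f⟩; exact Quotient.sound (Circ.Rel.comp_id f)
  assoc := by rintro W X Y Z ⟨f⟩ ⟨g⟩ ⟨h⟩; exact Quotient.sound (Circ.Rel.assoc f g h)

/-! ### An evaluation of circuits on lists of bits, used to separate maps of `TOF` -/

namespace Circ

/-- Evaluation of a circuit on lists of bits of the right length. -/
def eval : {n m : ℕ} → Circ n m → List (ZMod 2) → Option (List (ZMod 2))
  | _, _, id _, l => some l
  | _, _, comp f g, l => (eval f l).bind (eval g)
  | _, _, @tensor n _ _ _ f g, l =>
      (eval f (l.take n)).bind fun a => (eval g (l.drop n)).bind fun b => some (a ++ b)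
  | _, _, symm n _, l => some (l.drop n ++ l.take n)
  | _, _, ketOne, _ => some [1]
  | _, _, braOne, l => if l = [1] then some [] else none
  | _, _, tof, l =>
      match l with
      | [a, b, c] => some [a, b, a * b + c]
      | _ => none

theorem eval_cast {n m n' m' : ℕ} (hn : n = n') (hm : m = m') (f : Circ n m) :
    eval (cast hn hm f) = eval f := by
  subst hn hm; rfl

theorem eval_length {n m : ℕ} (f : Circ n m) : ∀ l r : List (ZMod 2), l.length = n →
    eval f l = some r → r.length = m := by
  induction f with
  | id n => intro l r hl h; simp [eval] at h; simp [← h, hl]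
  | comp f g hf hg =>
    intro l r hl h
    simp only [eval, Option.bind_eq_some_iff] at h
    obtain ⟨a, ha, hb⟩ := h
    exact hg a r (hf l a hl ha) hb
  | tensor f g hf hg =>
    intro l r hl h
    simp only [eval, Option.bind_eq_some_iff] at h
    obtain ⟨a, ha, b, hb, hab⟩ := h
    have h1 := hf _ a (by simp [hl]) ha
    have h2 := hg _ b (by simp [hl]) hb
    simp only [Option.some.injEq] at hab
    simp [← hab, h1, h2]
  | symm n m =>
    intro l r hl h
    simp only [eval, Option.some.injEq] at h
    subst h
    simp [hl]
  | ketOne =>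
    intro l r hl h
    simp only [eval, Option.some.injEq] at h
    simp [← h]
  | braOne =>
    intro l r hl h
    simp only [eval] at h
    split_ifs at h
    simp only [Option.some.injEq] at h
    simp [← h]
  | tof =>
    intro l r hl h
    simp only [eval] at h
    split at h
    · simp only [Option.some.injEq] at h
      simp [← h]
    · simp at h

theorem eval_injective {n m : ℕ} (f : Circ n m) : ∀ l l' r : List (ZMod 2), l.length = n →
    l'.length = n → eval f l = some r → eval f l' = some r → l = l' := by
  induction f with
  | id n => intro l l' r hl hl' h h'; simp [eval] at h h'; rw [h, h']
  | comp f g hf hg =>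
    intro l l' r hl hl' h h'
    simp only [eval, Option.bind_eq_some_iff] at h h'
    obtain ⟨a, ha, hb⟩ := h
    obtain ⟨a', ha', hb'⟩ := h'
    have := hg a a' r (eval_length f _ _ hl ha) (eval_length f _ _ hl' ha') hb hb'
    subst this
    exact hf _ _ _ hl hl' ha ha'
  | @tensor n m n' m' f g hf hg =>
    intro l l' r hl hl' h h'
    simp only [eval, Option.bind_eq_some_iff, Option.some.injEq] at h h'
    obtain ⟨a, ha, b, hb, hab⟩ := h
    obtain ⟨a', ha', b', hb', hab'⟩ := h'
    have e1 := eval_length f _ _ (by simp [hl]) ha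
    have e2 := eval_length f _ _ (by simp [hl']) ha'
    obtain ⟨rfl, rfl⟩ := List.append_inj (hab.trans hab'.symm) (e1.trans e2.symm)
    have t := hf _ _ _ (by simp [hl]) (by simp [hl']) ha ha'
    have d := hg _ _ _ (by simp [hl]) (by simp [hl']) hb hb'
    rw [← List.take_append_drop n l, ← List.take_append_drop n l', t, d]
  | symm n m =>
    intro l l' r hl hl' h h'
    simp only [eval, Option.some.injEq] at h h'
    obtain ⟨d, t⟩ := List.append_inj (h.trans h'.symm) (by simp [hl, hl'])
    rw [← List.take_append_drop n l, ← List.take_append_drop n l', t, d]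
  | ketOne =>
    intro l l' r hl hl' h h'
    rw [List.length_eq_zero_iff] at hl hl'
    rw [hl, hl']
  | braOne =>
    intro l l' r hl hl' h h'
    simp only [eval] at h h'
    split_ifs at h h' with p q
    rw [p, q]
  | tof =>
    intro l l' r hl hl' h h'
    simp only [eval] at h h'
    split at h
    · split at h'
      · rw [← h] at h'
        simp only [Option.some.injEq, List.cons.injEq, and_true] at h'
        obtain ⟨rfl, rfl, h3⟩ := h'
        rw [add_left_cancel h3]
      · simp at h'
    · simp at h

theorem eval_ext2 {f g : List (ZMod 2) → Option (List (ZMod 2))}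
    (h : ∀ a b : ZMod 2, f [a, b] = g [a, b]) (l : List (ZMod 2)) (hl : l.length = 2) :
    f l = g l := by
  match l, hl with
  | [a, b], _ => exact h a b

theorem eval_ext3 {f g : List (ZMod 2) → Option (List (ZMod 2))}
    (h : ∀ a b c : ZMod 2, f [a, b, c] = g [a, b, c]) (l : List (ZMod 2)) (hl : l.length = 3) :
    f l = g l := by
  match l, hl with
  | [a, b, c], _ => exact h a b c

theorem eval_ext4 {f g : List (ZMod 2) → Option (List (ZMod 2))}
    (h : ∀ a b c d : ZMod 2, f [a, b, c, d] = g [a, b, c, d]) (l : List (ZMod 2))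
    (hl : l.length = 4) : f l = g l := by
  match l, hl with
  | [a, b, c, d], _ => exact h a b c d

theorem eval_ext5 {f g : List (ZMod 2) → Option (List (ZMod 2))}
    (h : ∀ a b c d e : ZMod 2, f [a, b, c, d, e] = g [a, b, c, d, e]) (l : List (ZMod 2))
    (hl : l.length = 5) : f l = g l := by
  match l, hl with
  | [a, b, c, d, e], _ => exact h a b c d e

/-- The evaluation respects the defining congruence. -/
theorem Rel.eval_eq {n m : ℕ} {f g : Circ n m} (h : Rel f g) :
    ∀ l : List (ZMod 2), l.length = n → eval f l = eval g l := by
  induction h with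
  | refl f => intros; rfl
  | symm _ ih => intro l hl; exact (ih l hl).symm
  | trans _ _ ih ih' => intro l hl; exact (ih l hl).trans (ih' l hl)
  | @comp _ _ _ f f' g g' _ _ ih ih' =>
    intro l hl
    simp only [eval, ← ih l hl]
    cases h : eval f l with
    | none => rfl
    | some a => exact ih' a (eval_length f l a hl h)
  | tensor _ _ ih ih' =>
    intro l hl
    simp only [eval]
    rw [ih _ (by simp [hl]), ih' _ (by simp [hl])]
  | id_comp f => intros; simp [eval]
  | comp_id f => intros; simp only [eval]; exact Option.bind_fun_some _
  | assoc f g h => intros; simp only [eval]; rw [Option.bind_assoc]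
  | tensor_id n m => intros; simp [eval]
  | interchange f g f' g' =>
    intro l hl
    simp only [eval]
    cases h : eval f (l.take _) with
    | none => rfl
    | some a =>
      have ha := eval_length f _ _ (by simp [hl]) h
      simp only [Option.bind_some]
      cases h' : eval f' (l.drop _) with
      | none => simp
      | some b => simp [← ha]
  | @tensor_assoc n m n' m' n'' m'' f g h =>
    intro l hl
    rw [eval_cast]
    simp only [eval, List.take_take, List.drop_take, List.drop_drop, Nat.min_eq_left
      (Nat.le_add_right n n'), Nat.add_sub_cancel_left]
    simp [Option.bind_assoc]
  | tensor_unit f =>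
    intro l hl
    simp only [eval]
    simp only [Nat.add_zero] at hl
    rw [List.take_of_length_le hl.le, List.drop_of_length_le hl.le]
    simp
  | unit_tensor f => intro l hl; rw [eval_cast]; simp [eval]
  | @symm_natural n m n' m' f g =>
    intro l hl
    simp only [eval, Option.bind_some]
    have e1 : (l.drop n ++ l.take n).take n' = l.drop n := by
      rw [List.take_append_of_le_length (by simp [hl]), List.take_of_length_le (by simp [hl])]
    have e2 : (l.drop n ++ l.take n).drop n' = l.take n := by
      have : n' = (l.drop n).length := by simp [hl]
      conv_lhs => rw [this]
      simp
    rw [e1, e2]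
    cases h : eval f (l.take n) with
    | none => simp
    | some a =>
      have ha := eval_length f _ _ (by simp [hl]) h
      cases h' : eval g (l.drop n) with
      | none => simp
      | some b => simp [← ha]
  | symm_symm n m =>
    intro l hl
    have : m = (l.drop n).length := by simp [hl]
    simp only [eval, Option.bind_some]
    conv_lhs => rw [this]
    simp
  | symm_unit n =>
    intro l hl
    rw [eval_cast]
    simp only [eval]
    simp only [Nat.add_zero] at hl
    rw [List.take_of_length_le hl.le, List.drop_of_length_le hl.le]
    simp
  | hexagon n m k =>
    intro l hl
    simp only [eval, eval_cast, Option.bind_some]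
    obtain ⟨a, b, rfl, ha⟩ : ∃ a b, l = a ++ b ∧ a.length = n :=
      ⟨l.take n, l.drop n, by simp, by simp [hl]⟩
    obtain ⟨b, c, rfl, hb⟩ : ∃ b' c, b = b' ++ c ∧ b'.length = m :=
      ⟨b.take m, b.drop m, by simp, by simp at hl; simp; omega⟩
    subst ha hb
    have e1 : (a ++ (b ++ c)).drop (a.length + b.length) = c := by
      rw [← List.append_assoc, ← List.length_append, List.drop_left]
    have e2 : (a ++ (b ++ c)).take (a.length + b.length) = a ++ b := by
      rw [← List.append_assoc, ← List.length_append, List.take_left]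
    simp [e1, e2]
  | tof1 => exact eval_ext2 (by decide)
  | tof1_flip => exact eval_ext3 (by decide)
  | tof2 => exact eval_ext2 (by decide)
  | tof2_flip => exact eval_ext3 (by decide)
  | tof3 => exact eval_ext5 (by decide)
  | tof4 => exact eval_ext5 (by decide)
  | tof5 => exact eval_ext4 (by decide)
  | tof5_5 => exact eval_ext4 (by decide)
  | tof6 => exact eval_ext2 (by decide)
  | tof7 => intro l hl; match l, hl with | [a], _ => revert a; decide
  | tof8 => intro l hl; match l, hl with | [], _ => decide
  | tof9 => exact eval_ext3 (by decide)
  | tof10 => exact eval_ext4 (by decide)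
  | tof11 => exact eval_ext4 (by decide)
  | tof12 => exact eval_ext4 (by decide)
  | tof13 => exact eval_ext4 (by decide)
  | tof14 => exact eval_ext2 (by decide)
  | tof15 => exact eval_ext3 (by decide)
  | tof16 => exact eval_ext4 (by decide)

end Circ

/-! ### Points of `TOF` -/

namespace Mor

theorem mk_comp {n m k : ℕ} (f : Circ n m) (g : Circ m k) : mk (f ⨾ g) = comp (mk f) (mk g) := rfl

theorem mk_tensor {n m n' m' : ℕ} (f : Circ n m) (g : Circ n' m') :
    mk (f ⊠ g) = tensor (mk f) (mk g) := rfl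

theorem id_comp {n m : ℕ} (f : Mor n m) : comp (mk (Circ.id n)) f = f := by
  obtain ⟨f⟩ := f; exact Quotient.sound (Circ.Rel.id_comp f)

theorem comp_id {n m : ℕ} (f : Mor n m) : comp f (mk (Circ.id m)) = f := by
  obtain ⟨f⟩ := f; exact Quotient.sound (Circ.Rel.comp_id f)

theorem assoc {n m k l : ℕ} (f : Mor n m) (g : Mor m k) (h : Mor k l) :
    comp (comp f g) h = comp f (comp g h) := by
  obtain ⟨f⟩ := f; obtain ⟨g⟩ := g; obtain ⟨h⟩ := h
  exact Quotient.sound (Circ.Rel.assoc f g h)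

theorem interchange {n m k n' m' k' : ℕ} (f : Mor n m) (g : Mor m k) (f' : Mor n' m')
    (g' : Mor m' k') :
    comp (tensor f f') (tensor g g') = tensor (comp f g) (comp f' g') := by
  obtain ⟨f⟩ := f; obtain ⟨g⟩ := g; obtain ⟨f'⟩ := f'; obtain ⟨g'⟩ := g'
  exact Quotient.sound (Circ.Rel.interchange f g f' g').symm

local notation:70 f:70 " ⨟ " g:71 => Mor.comp (f :) (g :)
local notation:80 f:80 " ⊛ " g:81 => Mor.tensor (f :) (g :)

/-- The tensor product of points. -/
def pt {n m : ℕ} (p : Mor 0 n) (q : Mor 0 m) : Mor 0 (n + m) := tensor p q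

theorem pt_comp {n m n' m' : ℕ} (p : Mor 0 n) (q : Mor 0 n') (f : Mor n m) (g : Mor n' m') :
    comp (pt p q) (tensor f g) = pt (comp p f) (comp q g) := interchange p f q g

theorem pt_assoc_one {n m : ℕ} (p : Mor 0 n) (q : Mor 0 m) (r : Mor 0 1) :
    pt p (pt q r) = pt (pt p q) r := by
  obtain ⟨p⟩ := p; obtain ⟨q⟩ := q; obtain ⟨r⟩ := r
  exact Quotient.sound (Circ.Rel.tensor_assoc p q r).symm

theorem pt_assoc_zero {n m : ℕ} (p : Mor 0 n) (q : Mor 0 m) (r : Mor 0 0) :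
    pt p (pt q r) = pt (pt p q) r := by
  obtain ⟨p⟩ := p; obtain ⟨q⟩ := q; obtain ⟨r⟩ := r
  exact Quotient.sound (Circ.Rel.tensor_assoc p q r).symm

/-- The unique bit-string of length zero, as a point. -/
def unit : Mor 0 0 := mk (Circ.id 0)

/-- The point `|1⟩`. -/
def one : Mor 0 1 := mk Circ.ketOne

/-- The point `|0⟩`. -/
def zero : Mor 0 1 := mk Circ.ketZero

/-- The scalar `⟨0| ∘ |1⟩`. -/
def scal : Mor 0 0 := mk (Circ.ketOne ⨾ Circ.braZero)

theorem pt_unit {n : ℕ} (p : Mor 0 n) : pt p unit = p := by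
  obtain ⟨p⟩ := p; exact Quotient.sound (Circ.Rel.tensor_unit p)

theorem tensor_id0 {n m : ℕ} (f : Mor n m) : tensor f (mk (Circ.id 0)) = f := by
  obtain ⟨f⟩ := f; exact Quotient.sound (Circ.Rel.tensor_unit f)

theorem unit_pt1 (p : Mor 0 1) : pt unit p = p := by
  obtain ⟨p⟩ := p; exact Quotient.sound (Circ.Rel.unit_tensor p)

theorem id0_tensor10 (f : Mor 1 0) : tensor (mk (Circ.id 0)) f = f := by
  obtain ⟨p⟩ := f; exact Quotient.sound (Circ.Rel.unit_tensor p)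

theorem id0_tensor00 (f : Mor 0 0) : tensor (mk (Circ.id 0)) f = f := by
  obtain ⟨p⟩ := f; exact Quotient.sound (Circ.Rel.unit_tensor p)

theorem id0_tensor33 (f : Mor 3 3) : tensor (mk (Circ.id 0)) f = f := by
  obtain ⟨p⟩ := f; exact Quotient.sound (Circ.Rel.unit_tensor p)

theorem id0_tensor02 (f : Mor 0 2) : tensor (mk (Circ.id 0)) f = f := by
  obtain ⟨p⟩ := f; exact Quotient.sound (Circ.Rel.unit_tensor p)

theorem pt_symm {n m : ℕ} (p : Mor 0 n) (q : Mor 0 m) :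
    comp (pt p q) (mk (Circ.symm n m)) = pt q p := by
  have h0 : mk (Circ.symm 0 0) = mk (Circ.id 0) := Quotient.sound (Circ.Rel.symm_unit 0)
  have : comp (pt p q) (mk (Circ.symm n m)) = comp (mk (Circ.symm 0 0)) (pt q p) := by
    obtain ⟨p⟩ := p; obtain ⟨q⟩ := q
    exact Quotient.sound (Circ.Rel.symm_natural p q)
  rw [this, h0, id_comp]

theorem comm_one (s : Mor 0 0) (p : Mor 0 1) : pt s p = pt p s := by
  have h0 : mk (Circ.symm 1 0) = mk (Circ.id 1) := Quotient.sound (Circ.Rel.symm_unit 1)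
  have := pt_symm p s
  rw [h0] at this
  exact this.symm.trans (comp_id _)

/-- Three bits on three wires. -/
def pt3 (a b c : Mor 0 1) : Mor 0 3 := pt (pt a b) c

theorem pt3_eq (a b c : Mor 0 1) : pt3 a b c = pt a (pt b c) := (pt_assoc_one a b c).symm

theorem one_bra : comp one (mk Circ.braOne) = unit := Quotient.sound Circ.Rel.tof8

theorem scal_eq : comp zero (mk Circ.braOne) = scal :=
  assoc (mk Circ.ketOne) (mk Circ.not) (mk Circ.braOne)

theorem scal_sq_aux (s : Mor 0 0) (p : Mor 0 1) : s ⨟ p = pt s p := by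
  have : (s ⊛ mk (Circ.id 0)) ⨟ (mk (Circ.id 0) ⊛ p) = s ⨟ p := by
    rw [tensor_id0]; congr 1; exact unit_pt1 p
  rw [← this, interchange, comp_id]
  congr 1
  exact id_comp p

theorem tensor_pt2 (a : Mor 0 1) (q : Mor 0 2) : q ⨟ (a ⊛ mk (Circ.id 2)) = pt a q := by
  have h : comp (pt unit q) (a ⊛ mk (Circ.id 2)) = pt a q := by
    rw [pt_comp, comp_id]; unfold unit; rw [id_comp]
  rw [← h]; congr 1; exact (id0_tensor02 _).symm

theorem tensor_pt1 (a q : Mor 0 1) : q ⨟ (a ⊛ mk (Circ.id 1)) = pt a q := by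
  have h : comp (pt unit q) (a ⊛ mk (Circ.id 1)) = pt a q := by
    rw [pt_comp, comp_id]; unfold unit; rw [id_comp]
  rw [← h, unit_pt1]

theorem one_bra_zero : one ⨟ mk Circ.braZero = scal := rfl

theorem tof_one (b c : Mor 0 1) :
    pt3 one b c ⨟ mk Circ.tof = pt one (pt b c ⨟ mk Circ.cnot) := by
  have h : (one ⊛ mk (Circ.id 2)) ⨟ mk Circ.tof = one ⊛ mk Circ.cnot :=
    Quotient.sound Circ.Rel.tof1
  have h3 : pt one (pt b c ⨟ mk Circ.cnot) = comp (pt unit (pt b c)) (one ⊛ mk Circ.cnot) := by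
    rw [pt_comp]; unfold unit; rw [id_comp]
  rw [pt3_eq, ← tensor_pt2, assoc, h, h3]; congr 1; exact (id0_tensor02 _).symm

theorem tof_zero (b c : Mor 0 1) : pt3 zero b c ⨟ mk Circ.tof = pt3 zero b c := by
  have h : (zero ⊛ mk (Circ.id 2)) ⨟ mk Circ.tof = zero ⊛ mk (Circ.id 2) :=
    Quotient.sound Circ.Rel.tof2
  rw [pt3_eq, ← tensor_pt2, assoc, h]

theorem swap12 (a b c : Mor 0 1) : pt3 a b c ⨟ (mk Circ.swap ⊛ mk (Circ.id 1)) = pt3 b a c := by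
  rw [pt3]
  refine (pt_comp _ _ _ _).trans ?_
  rw [comp_id]; unfold Circ.swap
  exact congrArg (fun q => pt q c) (pt_symm a b)

theorem tof_swap (a b c : Mor 0 1) : pt3 a b c ⨟ mk Circ.tof =
    pt3 b a c ⨟ mk Circ.tof ⨟ (mk Circ.swap ⊛ mk (Circ.id 1)) := by
  have h : mk Circ.tof = (mk Circ.swap ⊛ mk (Circ.id 1)) ⨟ mk Circ.tof ⨟
    (mk Circ.swap ⊛ mk (Circ.id 1)) := Quotient.sound Circ.Rel.tof15
  conv_lhs => rw [h, ← assoc, ← assoc, swap12]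

theorem tof_one_zero (c : Mor 0 1) : pt3 one zero c ⨟ mk Circ.tof = pt3 one zero c := by
  rw [tof_swap, tof_zero, swap12]

theorem swap_bra : mk Circ.swap ⨟ (mk Circ.braOne ⊛ mk (Circ.id 1)) =
    mk (Circ.id 1) ⊛ mk Circ.braOne := by
  have h0 : mk (Circ.symm 1 0) = mk (Circ.id 1) := Quotient.sound (Circ.Rel.symm_unit 1)
  have h : (mk (Circ.id 1) ⊛ mk Circ.braOne) ⨟ mk (Circ.symm 1 0) =
      mk (Circ.symm 1 1) ⨟ (mk Circ.braOne ⊛ mk (Circ.id 1)) :=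
    Quotient.sound (Circ.Rel.symm_natural (Circ.id 1) Circ.braOne)
  rw [h0] at h
  exact h.symm.trans (comp_id _)

theorem tof_one_one (c : Mor 0 1) :
    pt3 one one c ⨟ mk Circ.tof = pt3 one one (c ⨟ mk Circ.not) := by
  have hA : c ⨟ mk Circ.not =
      pt one c ⨟ mk Circ.cnot ⨟ (mk Circ.braOne ⊛ mk (Circ.id 1)) := by
    rw [← tensor_pt1]
    change c ⨟ (((one ⊛ mk (Circ.id 1)) ⨟ mk Circ.cnot) ⨟
      (mk Circ.braOne ⊛ mk (Circ.id 1))) = _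
    rw [← assoc, ← assoc]
  have h1 := tof_swap one one c
  rw [tof_one] at h1 ⊢
  rw [pt3_eq, hA]
  generalize pt one c ⨟ mk Circ.cnot = X at h1 ⊢
  have h2 := congrArg (fun q : Mor 0 3 => q ⨟ (mk Circ.braOne ⊛ mk (Circ.id 2))) h1
  have h3 : pt one X ⨟ (mk Circ.braOne ⊛ mk (Circ.id 2)) = X := by
    refine (pt_comp _ _ _ _).trans ?_
    rw [one_bra, comp_id]; exact id0_tensor02 _
  have e1 : mk Circ.braOne ⊛ mk (Circ.id 2) =
      (mk Circ.braOne ⊛ mk (Circ.id 1)) ⊛ mk (Circ.id 1) := by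
    have : mk (Circ.id 2) = mk (Circ.id 1) ⊛ mk (Circ.id 1) :=
      Quotient.sound (Circ.Rel.tensor_id 1 1).symm
    rw [this]
    exact Quotient.sound (Circ.Rel.tensor_assoc Circ.braOne (Circ.id 1) (Circ.id 1)).symm
  have e2 : (mk (Circ.id 1) ⊛ mk Circ.braOne) ⊛ mk (Circ.id 1) =
      mk (Circ.id 1) ⊛ (mk Circ.braOne ⊛ mk (Circ.id 1)) :=
    Quotient.sound (Circ.Rel.tensor_assoc (Circ.id 1) Circ.braOne (Circ.id 1))
  have hsw : (mk Circ.swap ⊛ mk (Circ.id 1)) ⨟ (mk Circ.braOne ⊛ mk (Circ.id 2)) =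
      mk (Circ.id 1) ⊛ (mk Circ.braOne ⊛ mk (Circ.id 1)) := by
    rw [e1]
    refine (interchange _ _ _ _).trans ?_
    rw [comp_id, ← e2]
    exact congrArg (fun q => tensor q (mk (Circ.id 1))) swap_bra
  have h4 : pt one X ⨟ (mk Circ.swap ⊛ mk (Circ.id 1)) ⨟ (mk Circ.braOne ⊛ mk (Circ.id 2)) =
      pt one (X ⨟ (mk Circ.braOne ⊛ mk (Circ.id 1))) := by
    rw [assoc, hsw]
    refine (pt_comp one X _ _).trans ?_
    rw [comp_id]
  have h5 : X = pt one (X ⨟ (mk Circ.braOne ⊛ mk (Circ.id 1))) := h3.symm.trans (h2.trans h4)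
  exact congrArg (pt one) h5

theorem one_not : one ⨟ mk Circ.not = zero := rfl

theorem cancel_one_one {p q : Mor 0 1} (h : pt3 one one p = pt3 one one q) : p = q := by
  have key : ∀ p : Mor 0 1, pt3 one one p ⨟
      ((mk Circ.braOne ⊛ mk Circ.braOne) ⊛ mk (Circ.id 1)) = p := by
    intro p
    refine (pt_comp _ _ _ _).trans ?_
    rw [comp_id]
    have : pt one one ⨟ (mk Circ.braOne ⊛ mk Circ.braOne) = unit := by
      refine (pt_comp _ _ _ _).trans ?_
      rw [one_bra]; exact pt_unit unit
    exact (congrArg (fun q => pt q p) this).trans (unit_pt1 p)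
  rw [← key p, h, key q]

theorem zero_not : zero ⨟ mk Circ.not = one := by
  apply cancel_one_one
  have h9 : mk Circ.tof ⨟ mk Circ.tof = mk (Circ.id 3) := Quotient.sound Circ.Rel.tof9
  rw [← tof_one_one, ← one_not, ← tof_one_one, assoc, h9, comp_id]

theorem zero_braZero : zero ⨟ mk Circ.braZero = unit := by
  change zero ⨟ (mk Circ.not ⨟ mk Circ.braOne) = unit
  rw [← assoc, zero_not, one_bra]

/-! Powers of the scalar. -/

theorem scal_cut (p : Mor 0 1) : pt scal p = pt (pt scal (p ⨟ mk Circ.braOne)) one := by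
  have h7 : scal ⊛ mk (Circ.id 1) = scal ⊛ (mk Circ.braOne ⨟ one) := Quotient.sound Circ.Rel.tof7
  have e : ∀ f : Mor 1 1, pt unit p ⨟ (scal ⊛ f) = pt scal (p ⨟ f) := by
    intro f
    refine (pt_comp _ _ _ _).trans ?_
    unfold unit; rw [id_comp]
  have := congrArg (fun q : Mor 1 1 => comp (pt unit p) q) h7
  have h2 := (e _).symm.trans (this.trans (e _))
  rw [comp_id, ← assoc, scal_sq_aux, pt_assoc_one] at h2
  exact h2

theorem scal_cube : scal = pt (pt scal scal) scal := by
  have h := scal_cut zero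
  rw [scal_eq] at h
  have h2 := congrArg (fun q : Mor 0 1 => q ⨟ (mk (Circ.id 0) ⊛ mk Circ.braZero)) h
  have l : pt scal zero ⨟ (mk (Circ.id 0) ⊛ mk Circ.braZero) = scal := by
    refine (pt_comp _ _ _ _).trans ?_
    rw [comp_id, zero_braZero, pt_unit]
  have r : pt (pt scal scal) one ⨟ (mk (Circ.id 0) ⊛ mk Circ.braZero) =
      pt (pt scal scal) scal := by
    refine (pt_comp _ _ _ _).trans ?_
    rw [comp_id, one_bra_zero]
  exact l.symm.trans (h2.trans r)

theorem scal_pt2 (s : Mor 0 0) (a b : Mor 0 1) : pt s (pt a b) = pt (pt a b) s := by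
  have e1 : pt s (pt a b) = pt (pt s a) b := pt_assoc_one s a b
  have e2 : pt (pt a s) b = pt a (pt s b) := (pt_assoc_one a s b).symm
  have e3 : pt a (pt b s) = pt (pt a b) s := pt_assoc_zero a b s
  rw [comm_one] at e1
  rw [comm_one s b] at e2
  exact e1.trans (e2.trans e3)

theorem scal_pt3 (s : Mor 0 0) (a b c : Mor 0 1) :
    pt s (pt3 a b c) = pt (pt a b) (pt s c) := by
  have e1 : pt s (pt3 a b c) = pt (pt s (pt a b)) c := pt_assoc_one s (pt a b) c
  have e2 : pt (pt a b) (pt s c) = pt (pt (pt a b) s) c := pt_assoc_one (pt a b) s c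
  exact e1.trans ((congrArg (fun q : Mor 0 2 => (pt q c : Mor 0 3)) (scal_pt2 s a b)).trans e2.symm)

theorem scal_tof (s : Mor 0 0) (p : Mor 0 3) :
    comp (pt s p) (mk Circ.tof) = pt s (p ⨟ mk Circ.tof) := by
  have : pt s p ⨟ (mk (Circ.id 0) ⊛ mk Circ.tof) = pt s (p ⨟ mk Circ.tof) := by
    refine (pt_comp _ _ _ _).trans ?_
    rw [comp_id]
  rw [← this]
  congr 1
  exact (id0_tensor33 _).symm

theorem scal_bra (s : Mor 0 0) (p : Mor 0 1) :
    comp (pt s p) (mk Circ.braOne) = pt s (p ⨟ mk Circ.braOne) := by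
  have : pt s p ⨟ (mk (Circ.id 0) ⊛ mk Circ.braOne) = pt s (p ⨟ mk Circ.braOne) := by
    refine (pt_comp _ _ _ _).trans ?_
    rw [comp_id]
  rw [← this]
  congr 1
  exact (id0_tensor10 _).symm

theorem scal_idem : pt scal scal = scal := by
  have hz : pt scal zero = pt (pt scal scal) one := by
    have h := scal_cut zero
    rwa [scal_eq] at h
  have a1 : (pt scal (pt3 zero one one) : Mor 0 3) = pt (pt scal scal) (pt3 one one one) := by
    have e1 : pt scal (pt3 zero one one) = pt (pt scal (pt zero one)) one :=
      pt_assoc_one scal (pt zero one) one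
    have e2 : pt scal (pt zero one) = pt (pt scal zero) one := pt_assoc_one scal zero one
    have e3 : pt (pt scal scal) (pt3 one one one) = pt (pt (pt scal scal) (pt one one)) one :=
      pt_assoc_one (pt scal scal) (pt one one) one
    have e4 : pt (pt scal scal) (pt one one) = pt (pt (pt scal scal) one) one :=
      pt_assoc_one (pt scal scal) one one
    rw [hz] at e2
    exact e1.trans ((congrArg (fun q : Mor 0 2 => (pt q one : Mor 0 3)) (e2.trans e4.symm)).trans
      e3.symm)
  have a2 := congrArg (fun q : Mor 0 3 => q ⨟ mk Circ.tof) a1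
  have a3 := (scal_tof _ _).symm.trans (a2.trans (scal_tof _ _))
  rw [tof_zero, tof_one_one, one_not] at a3
  have a4 := (scal_pt3 _ _ _ _).symm.trans ((a1.symm.trans a3).trans (scal_pt3 _ _ _ _))
  have a5 : pt (pt scal scal) one = pt (pt scal scal) zero := cancel_one_one a4
  have a6 := congrArg (fun q : Mor 0 1 => q ⨟ mk Circ.braOne) a5
  have a7 := (scal_bra _ _).symm.trans (a6.trans (scal_bra _ _))
  rw [one_bra, scal_eq, pt_unit, ← scal_cube] at a7
  exact a7

theorem scal_zero : pt scal zero = pt scal one := by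
  have h := scal_cut zero
  rwa [scal_eq, scal_idem] at h

/-- The point `|b⟩` given by a bit. -/
def bit (b : ZMod 2) : Mor 0 1 := if b = 1 then one else zero

/-- The point `|b₁, …, bₙ⟩` given by a string of bits. -/
def ket : (n : ℕ) → (Fin n → ZMod 2) → Mor 0 n
  | 0, _ => unit
  | n + 1, b => pt (ket n fun i => b i.castSucc) (bit (b (Fin.last n)))

/-- The degenerate point: the scalar `⟨0| ∘ |1⟩` next to `|1, …, 1⟩`. -/
def omega : (n : ℕ) → Mor 0 n
  | 0 => scal
  | n + 1 => pt (omega n) one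

theorem omega_scal : ∀ n : ℕ, pt (omega n) scal = omega n
  | 0 => scal_idem
  | n + 1 => by
    have e1 : pt (pt (omega n) one) scal = pt (omega n) (pt one scal) :=
      (pt_assoc_zero _ _ _).symm
    have e2 : pt (omega n) (pt scal one) = pt (pt (omega n) scal) one := pt_assoc_one _ _ _
    rw [omega_scal n] at e2
    rw [comm_one] at e2
    exact e1.trans e2

theorem omega_zero (n : ℕ) : pt (omega n) zero = omega (n + 1) := by
  have e1 : pt (omega n) (pt scal zero) = pt (pt (omega n) scal) zero := pt_assoc_one _ _ _
  have e2 : pt (omega n) (pt scal one) = pt (pt (omega n) scal) one := pt_assoc_one _ _ _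
  rw [omega_scal] at e1 e2
  rw [scal_zero] at e1
  exact e1.symm.trans e2

theorem omega_bit (n : ℕ) (b : ZMod 2) : pt (omega n) (bit b) = omega (n + 1) := by
  unfold bit
  split_ifs
  · rfl
  · exact omega_zero n

theorem omega_ket (n : ℕ) : ∀ (m : ℕ) (b : Fin m → ZMod 2), pt (omega n) (ket m b) = omega (n + m)
  | 0, _ => pt_unit _
  | m + 1, b => by
    have e : pt (omega n) (pt (ket m fun i => b i.castSucc) (bit (b (Fin.last m)))) =
      pt (pt (omega n) (ket m fun i => b i.castSucc)) (bit (b (Fin.last m))) := pt_assoc_one _ _ _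
    rw [omega_ket n m, omega_bit] at e
    exact e

theorem omega_omega (n : ℕ) : ∀ m : ℕ, pt (omega n) (omega m) = omega (n + m)
  | 0 => omega_scal n
  | m + 1 => by
    have e : pt (omega n) (pt (omega m) one) = pt (pt (omega n) (omega m)) one :=
      pt_assoc_one _ _ _
    rw [omega_omega n m] at e
    exact e

theorem ket_scal : ∀ (n : ℕ) (b : Fin n → ZMod 2), pt (ket n b) scal = omega n
  | 0, _ => (id0_tensor00 scal : _)
  | n + 1, b => by
    have e1 : pt (pt (ket n fun i => b i.castSucc) (bit (b (Fin.last n)))) scal =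
      pt (ket n fun i => b i.castSucc) (pt (bit (b (Fin.last n))) scal) :=
      (pt_assoc_zero _ _ _).symm
    have e2 : pt (ket n fun i => b i.castSucc) (pt scal (bit (b (Fin.last n)))) =
      pt (pt (ket n fun i => b i.castSucc) scal) (bit (b (Fin.last n))) := pt_assoc_one _ _ _
    rw [ket_scal n, comm_one] at e2
    exact e1.trans (e2.trans (omega_bit n _))

theorem ket_omega (n : ℕ) (b : Fin n → ZMod 2) : ∀ m : ℕ, pt (ket n b) (omega m) = omega (n + m)
  | 0 => ket_scal n b
  | m + 1 => by
    have e : pt (ket n b) (pt (omega m) one) = pt (pt (ket n b) (omega m)) one :=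
      pt_assoc_one _ _ _
    rw [ket_omega n b m] at e
    exact e

theorem ket_ket (n : ℕ) (b : Fin n → ZMod 2) : ∀ (m : ℕ) (c : Fin m → ZMod 2),
    pt (ket n b) (ket m c) = ket (n + m) (Fin.append b c)
  | 0, c => by
    have : Fin.append b c = b := by
      funext i; exact Fin.append_left b c i
    rw [this]
    exact pt_unit _
  | m + 1, c => by
    have e : pt (ket n b) (pt (ket m fun i => c i.castSucc) (bit (c (Fin.last m)))) =
      pt (pt (ket n b) (ket m fun i => c i.castSucc)) (bit (c (Fin.last m))) :=
      pt_assoc_one _ _ _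
    rw [ket_ket n b m] at e
    refine e.trans ?_
    have h1 : (fun i : Fin (n + m) => Fin.append b c (Fin.castSucc i)) =
        Fin.append b fun i => c i.castSucc := by
      funext i
      refine Fin.addCases (fun i => ?_) (fun i => ?_) i
      · rw [Fin.append_left]; exact Fin.append_left b c i
      · rw [Fin.append_right]; exact Fin.append_right b c i.castSucc
    have h2 : Fin.append b c (Fin.last (n + m)) = c (Fin.last m) :=
      Fin.append_right b c (Fin.last m)
    change _ = pt (ket (n + m) fun i => Fin.append b c (Fin.castSucc i))
      (bit (Fin.append b c (Fin.last (n + m))))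
    rw [h1, h2]

/-- A point is good when it is a bit-string or degenerate. -/
def Good {n : ℕ} (p : Mor 0 n) : Prop := (∃ b : Fin n → ZMod 2, p = ket n b) ∨ p = omega n

theorem Good.pt {n m : ℕ} {p : Mor 0 n} {q : Mor 0 m} (hp : Good p) (hq : Good q) :
    Good (pt p q) := by
  rcases hp with ⟨b, rfl⟩ | rfl <;> rcases hq with ⟨c, rfl⟩ | rfl
  · exact Or.inl ⟨_, ket_ket n b m c⟩
  · exact Or.inr (ket_omega n b m)
  · exact Or.inr (omega_ket n m c)
  · exact Or.inr (omega_omega n m)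

theorem good_bit (b : ZMod 2) : Good (bit b) := by
  refine Or.inl ⟨fun _ => b, ?_⟩
  exact (unit_pt1 (bit b)).symm

theorem ket_split {n m : ℕ} (b : Fin (n + m) → ZMod 2) : ket (n + m) b =
    pt (ket n fun i => b (Fin.castAdd m i)) (ket m fun i => b (Fin.natAdd n i)) := by
  rw [ket_ket, Fin.append_castAdd_natAdd]

theorem good_one : Good one := good_bit 1

theorem good_zero : Good zero := good_bit 0

theorem omega_comp_and_good {n m : ℕ} (f : Circ n m) :
    omega n ⨟ mk f = omega m ∧ ∀ b, Good (ket n b ⨟ mk f) := by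
  induction f with
  | id n => exact ⟨comp_id _, fun b => Or.inl ⟨b, comp_id _⟩⟩
  | comp f g hf hg =>
    refine ⟨?_, fun b => ?_⟩
    · rw [mk_comp, ← assoc, hf.1, hg.1]
    · rw [mk_comp, ← assoc]
      rcases hf.2 b with ⟨c, hc⟩ | hc
      · rw [hc]; exact hg.2 c
      · rw [hc, hg.1]; exact Or.inr rfl
  | @tensor n m n' m' f g hf hg =>
    refine ⟨?_, fun b => ?_⟩
    · rw [mk_tensor, ← omega_omega, pt_comp, hf.1, hg.1, omega_omega]
    · rw [mk_tensor, ket_split, pt_comp]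
      exact (hf.2 _).pt (hg.2 _)
  | symm n m =>
    refine ⟨?_, fun b => ?_⟩
    · rw [← omega_omega, pt_symm, omega_omega]
    · rw [ket_split, pt_symm]
      exact Good.pt (Or.inl ⟨_, rfl⟩) (Or.inl ⟨_, rfl⟩)
  | ketOne =>
    refine ⟨scal_sq_aux scal one, fun b => ?_⟩
    have : ket 0 b ⨟ mk Circ.ketOne = one := id_comp _
    rw [this]
    exact good_one
  | braOne =>
    refine ⟨?_, fun b => ?_⟩
    · refine (scal_bra scal one).trans ?_
      rw [one_bra]; exact pt_unit _
    · have : ket 1 b = bit (b 0) := unit_pt1 _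
      rw [this]
      unfold bit
      split_ifs
      · rw [one_bra]; exact Or.inl ⟨fun i => 0, rfl⟩
      · rw [scal_eq]; exact Or.inr rfl
  | tof =>
    refine ⟨?_, fun b => ?_⟩
    · have e1 : pt scal (pt3 one one one) = omega 3 := by
        have e1 : pt scal (pt3 one one one) = pt (pt scal (pt one one)) one :=
          pt_assoc_one scal (pt one one) one
        have e2 : pt scal (pt one one) = pt (pt scal one) one := pt_assoc_one scal one one
        exact e1.trans (congrArg (fun q : Mor 0 2 => (pt q one : Mor 0 3)) e2)
      have e2 : pt scal (pt3 one one zero) = omega 3 := by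
        have e1 : pt scal (pt3 one one zero) = pt (pt scal (pt one one)) zero :=
          pt_assoc_one scal (pt one one) zero
        have e2 : pt scal (pt one one) = pt (pt scal one) one := pt_assoc_one scal one one
        exact e1.trans ((congrArg (fun q : Mor 0 2 => (pt q zero : Mor 0 3)) e2).trans
          (omega_zero 2))
      have e3 := congrArg (fun q : Mor 0 3 => q ⨟ mk Circ.tof) e1
      have e4 := e3.symm.trans (scal_tof _ _)
      rw [tof_one_one, one_not] at e4
      exact e4.trans e2
    · have hb : ket 3 b = pt3 (bit (b 0)) (bit (b 1)) (bit (b 2)) := by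
        have : ket 1 (fun i => b (Fin.castSucc (Fin.castSucc i))) = bit (b 0) := unit_pt1 _
        change pt (pt (ket 1 (fun i => b (Fin.castSucc (Fin.castSucc i)))) _) _ = _
        rw [this]; rfl
      have g3 : ∀ p q r : Mor 0 1, Good p → Good q → Good r → Good (pt3 p q r) :=
        fun p q r hp hq hr => (hp.pt hq).pt hr
      rw [hb]
      have hx := good_bit (b 0)
      have hy := good_bit (b 1)
      have hz := good_bit (b 2)
      by_cases h0 : b 0 = 1
      · have h0' : bit (b 0) = one := if_pos h0
        by_cases h1 : b 1 = 1
        · have h1' : bit (b 1) = one := if_pos h1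
          rw [h0', h1', tof_one_one]
          refine g3 _ _ _ good_one good_one ?_
          by_cases h2 : b 2 = 1
          · have h2' : bit (b 2) = one := if_pos h2
            rw [h2', one_not]; exact good_zero
          · have h2' : bit (b 2) = zero := if_neg h2
            rw [h2', zero_not]; exact good_one
        · have h1' : bit (b 1) = zero := if_neg h1
          rw [h0', h1', tof_one_zero]
          exact g3 _ _ _ good_one good_zero hz
      · have h0' : bit (b 0) = zero := if_neg h0
        rw [h0', tof_zero]
        exact g3 _ _ _ good_zero hy hz

theorem good {n : ℕ} (p : Mor 0 n) : Good p := by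
  obtain ⟨f⟩ := p
  have h := (omega_comp_and_good f).2 Fin.elim0
  have : ket 0 Fin.elim0 ⨟ mk f = mk f := id_comp _
  rw [this] at h
  exact h

theorem omega_comp {n m : ℕ} (f : Mor n m) : omega n ⨟ f = omega m := by
  obtain ⟨f⟩ := f
  exact (omega_comp_and_good f).1

/-! ### Total points -/

/-- A map `f` of `TOF` is total when its restriction `f f°` is an identity, where `f°` is obtained
by flipping horizontally a circuit that presents `f`. In the inverse category `TOF` the map `f°` is
the partial inverse of `f`, so the condition does not depend on the circuit chosen. -/
def IsTotal {n m : ℕ} (f : Mor n m) : Prop :=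
  ∃ c : Circ n m, mk c = f ∧ mk (c ⨾ c.dag) = mk (Circ.id n)

theorem eval_mk_eq {n m : ℕ} {f g : Circ n m} (h : mk f = mk g) (l : List (ZMod 2))
    (hl : l.length = n) : f.eval l = g.eval l :=
  Circ.Rel.eval_eq (Quotient.exact h) l hl

/-- A circuit presenting `|b₁, …, bₙ⟩`. -/
def ketCirc : (n : ℕ) → (Fin n → ZMod 2) → Circ 0 n
  | 0, _ => Circ.id 0
  | n + 1, b => Circ.tensor (ketCirc n fun i => b i.castSucc)
      (if b (Fin.last n) = 1 then Circ.ketOne else Circ.ketZero)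

theorem mk_ketCirc : ∀ (n : ℕ) (b : Fin n → ZMod 2), mk (ketCirc n b) = ket n b
  | 0, _ => rfl
  | n + 1, b => by
    unfold ketCirc ket bit
    rw [← mk_ketCirc n]
    split_ifs <;> rfl

theorem eval_ketCirc : ∀ (n : ℕ) (b : Fin n → ZMod 2), (ketCirc n b).eval [] = some (List.ofFn b)
  | 0, _ => rfl
  | n + 1, b => by
    rw [List.ofFn_succ']
    simp only [ketCirc, Circ.eval, List.take_nil, List.drop_nil, eval_ketCirc n, Option.bind_some,
      List.concat_eq_append]
    split_ifs with h
    · rw [h]; rfl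
    · have h0 : ∀ x : ZMod 2, x ≠ 1 → x = 0 := by decide
      rw [h0 _ h]; rfl

/-- A circuit presenting the degenerate point. -/
def omegaCirc : (n : ℕ) → Circ 0 n
  | 0 => Circ.ketOne ⨾ Circ.braZero
  | n + 1 => Circ.tensor (omegaCirc n) Circ.ketOne

theorem mk_omegaCirc : ∀ n : ℕ, mk (omegaCirc n) = omega n
  | 0 => rfl
  | n + 1 => by unfold omegaCirc omega; rw [← mk_omegaCirc n]; rfl

theorem eval_omegaCirc : ∀ n : ℕ, (omegaCirc n).eval [] = none
  | 0 => by decide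
  | n + 1 => by simp [omegaCirc, Circ.eval, eval_omegaCirc n]

theorem bit_dag (b : ZMod 2) :
    mk ((if b = 1 then Circ.ketOne else Circ.ketZero) ⨾
      (if b = 1 then Circ.ketOne else Circ.ketZero : Circ 0 1).dag) = unit := by
  split_ifs
  · exact one_bra
  · have : mk (Circ.dag Circ.ketZero) = mk Circ.braZero := by
      have hc : mk Circ.cnot.dag = mk Circ.cnot :=
        (assoc (one ⊛ mk (Circ.id 2)) (mk Circ.tof) (mk Circ.braOne ⊛ mk (Circ.id 2))).symm
      have hn : mk Circ.not.dag = mk Circ.not := by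
        change (one ⊛ mk (Circ.id 1)) ⨟ (mk Circ.cnot.dag ⨟ (mk Circ.braOne ⊛ mk (Circ.id 1))) = _
        rw [hc, ← assoc]; rfl
      change mk Circ.not.dag ⨟ mk Circ.braOne = _
      rw [hn]; rfl
    rw [mk_comp, this]
    exact zero_braZero

theorem isTotal_ket : ∀ (n : ℕ) (b : Fin n → ZMod 2), IsTotal (ket n b) := by
  intro n b
  refine ⟨ketCirc n b, mk_ketCirc n b, ?_⟩
  induction n with
  | zero => exact comp_id (mk (Circ.id 0))
  | succ n ih =>
    have h := interchange (mk (ketCirc n fun i => b i.castSucc))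
      (mk (ketCirc n fun i => b i.castSucc).dag)
      (mk (if b (Fin.last n) = 1 then Circ.ketOne else Circ.ketZero))
      (mk (if b (Fin.last n) = 1 then Circ.ketOne else Circ.ketZero : Circ 0 1).dag)
    refine h.trans ?_
    rw [← mk_comp, ← mk_comp, ih, bit_dag]
    exact pt_unit unit

theorem not_isTotal_omega (n : ℕ) : ¬ IsTotal (omega n) := by
  rintro ⟨c, hc, ht⟩
  rw [← mk_omegaCirc] at hc
  have h1 := eval_mk_eq hc [] rfl
  have h2 := eval_mk_eq ht [] rfl
  rw [eval_omegaCirc] at h1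
  simp [Circ.eval, h1] at h2

theorem isTotal_point_iff {n : ℕ} (p : Mor 0 n) : IsTotal p ↔ ∃ b, p = ket n b := by
  constructor
  · intro h
    rcases good p with hb | rfl
    · exact hb
    · exact absurd h (not_isTotal_omega n)
  · rintro ⟨b, rfl⟩
    exact isTotal_ket n b

theorem ket_injective (n : ℕ) : Function.Injective (ket n) := by
  intro b c h
  rw [← mk_ketCirc, ← mk_ketCirc] at h
  have := eval_mk_eq h [] rfl
  rw [eval_ketCirc, eval_ketCirc] at this
  exact List.ofFn_injective (Option.some.inj this)

theorem isTotal_of_comp {n m : ℕ} (p : Mor 0 n) (f : Mor n m) (h : IsTotal (p ⨟ f)) :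
    IsTotal p := by
  rcases good p with ⟨b, rfl⟩ | rfl
  · exact isTotal_ket n b
  · rw [omega_comp] at h
    exact absurd h (not_isTotal_omega m)

theorem point_comp_injective {n m : ℕ} (f : Mor n m) (p q : Mor 0 n) (hp : IsTotal (p ⨟ f))
    (h : p ⨟ f = q ⨟ f) : p = q := by
  have hq : IsTotal (q ⨟ f) := h ▸ hp
  obtain ⟨b, rfl⟩ := (isTotal_point_iff p).1 (isTotal_of_comp p f hp)
  obtain ⟨c, rfl⟩ := (isTotal_point_iff q).1 (isTotal_of_comp q f hq)
  obtain ⟨d, hd⟩ := (isTotal_point_iff _).1 hp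
  obtain ⟨f⟩ := f
  have hd' := h.symm.trans hd
  rw [← mk_ketCirc n, ← mk_ketCirc] at hd hd'
  have e1 := eval_mk_eq (f := ketCirc n b ⨾ f) hd [] rfl
  have e2 := eval_mk_eq (f := ketCirc n c ⨾ f) hd' [] rfl
  simp only [Circ.eval, eval_ketCirc, Option.bind_some] at e1 e2
  have := Circ.eval_injective f _ _ _ (by simp) (by simp) e1 e2
  rw [List.ofFn_injective this]

end Mor

/-! ### Partial isomorphisms of sets -/

/-- The category of sets and partial isomorphisms. -/
structure Pinj where
  carrier : Type

instance : Category Pinj where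
  Hom X Y := X.carrier ≃. Y.carrier
  id X := PEquiv.refl X.carrier
  comp f g := PEquiv.trans f g
  id_comp f := PEquiv.refl_trans f
  comp_id f := PEquiv.trans_refl f
  assoc f g h := PEquiv.trans_assoc f g h

/-- The set of bit-strings of length `n`, the `n`-th power of the two element set. -/
def bitStrings (n : ℕ) : Pinj := ⟨Fin n → ZMod 2⟩

/-- The full subcategory of `Pinj` on the finite powers of the two element set. -/
abbrev FPinj2 : Type := InducedCategory Pinj bitStrings

/-- The set of total points of an object of `TOF`. -/
abbrev TotalPoint (n : ℕ) : Type := {p : Mor 0 n // p.IsTotal}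

open Classical in
/-- A map `f` sends the total point `p` to the composite of `p` and `f` when that is total, and is
undefined at `p` otherwise. -/
noncomputable def onPoints {n m : ℕ} (f : Mor n m) : TotalPoint n ≃. TotalPoint m where
  toFun p := if h : (Mor.comp p.1 f).IsTotal then some ⟨Mor.comp p.1 f, h⟩ else none
  invFun q := if h : ∃ p : TotalPoint n, Mor.comp p.1 f = q.1 then some h.choose else none
  inv p q := by
    constructor
    · intro h
      change _ = _ at h
      split_ifs at h with hp
      have hc := hp.choose_spec
      rw [Option.some.inj h] at hc
      have ht : (Mor.comp p.1 f).IsTotal := hc ▸ q.2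
      rw [dif_pos ht]
      exact congrArg some (Subtype.ext hc)
    · intro h
      change _ = _ at h
      split_ifs at h with hp
      have hq : Mor.comp p.1 f = q.1 := congrArg Subtype.val (Option.some.inj h)
      have he : ∃ p : TotalPoint n, Mor.comp p.1 f = q.1 := ⟨p, hq⟩
      rw [dif_pos he]
      refine congrArg some (Subtype.ext ?_)
      refine Mor.point_comp_injective f _ _ ?_ (he.choose_spec.trans hq.symm)
      rw [he.choose_spec]
      exact q.2

open Classical in
theorem onPoints_eq_some_iff {n m : ℕ} (f : Mor n m) (p : TotalPoint n) (q : TotalPoint m) :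
    onPoints f p = some q ↔ Mor.comp p.1 f = q.1 := by
  change (if h : (Mor.comp p.1 f).IsTotal then some (⟨Mor.comp p.1 f, h⟩ : TotalPoint m) else none)
    = some q ↔ _
  constructor
  · intro h
    split_ifs at h with hp
    exact congrArg Subtype.val (Option.some.inj h)
  · intro h
    have ht : (Mor.comp p.1 f).IsTotal := h ▸ q.2
    rw [dif_pos ht]
    exact congrArg some (Subtype.ext h)

/-- The functor `H₀` which evaluates the maps of `TOF` on total points. -/
noncomputable def H0 : TOF ⥤ Pinj where
  obj X := ⟨TotalPoint X.wires⟩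
  map f := onPoints f
  map_id X := by
    refine PEquiv.ext fun p => ?_
    refine ((onPoints_eq_some_iff _ p p).2 ?_)
    exact Mor.comp_id _
  map_comp {X Y Z} f g := by
    refine PEquiv.ext fun p => Option.ext fun r => ?_
    refine (onPoints_eq_some_iff _ p r).trans ?_
    refine Iff.trans ?_ (PEquiv.trans_eq_some (onPoints f) (onPoints g) p r).symm
    have ha : Mor.comp p.1 (f ≫ g) = Mor.comp (Mor.comp p.1 f) g := (Mor.assoc p.1 f g).symm
    constructor
    · intro h
      have ht : (Mor.comp (Mor.comp p.1 f) g).IsTotal := by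
        rw [← ha, h]; exact r.2
      refine ⟨⟨Mor.comp p.1 f, Mor.isTotal_of_comp _ _ ht⟩, ?_, ?_⟩
      · exact (onPoints_eq_some_iff f p _).2 rfl
      · exact (onPoints_eq_some_iff g _ r).2 (ha.symm.trans h)
    · rintro ⟨q, hq, hr⟩
      have hq' := (onPoints_eq_some_iff f p q).1 hq
      have hr' := (onPoints_eq_some_iff g q r).1 hr
      rw [ha, hq', hr']

/-- The identification of bit-strings `b` with the total points `|b₁, …, bₙ⟩`. -/
noncomputable def ketEquiv (n : ℕ) : (Fin n → ZMod 2) ≃ TotalPoint n :=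
  Equiv.ofBijective (fun b => ⟨Mor.ket n b, Mor.isTotal_ket n b⟩)
    ⟨fun _ _ h => Mor.ket_injective n (congrArg Subtype.val h), fun p => by
      obtain ⟨b, hb⟩ := (Mor.isTotal_point_iff p.1).1 p.2
      exact ⟨b, Subtype.ext hb.symm⟩⟩

/-- The identification of bit-strings with total points, as an isomorphism in `Pinj`. -/
noncomputable def ketIso (X : TOF) : bitStrings X.wires ≅ H0.obj X where
  hom := (ketEquiv X.wires).toPEquiv
  inv := (ketEquiv X.wires).symm.toPEquiv
  hom_inv_id := by
    refine (Equiv.toPEquiv_trans (ketEquiv X.wires) (ketEquiv X.wires).symm).symm.trans ?_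
    exact congrArg Equiv.toPEquiv (Equiv.self_trans_symm (ketEquiv X.wires))
  inv_hom_id := by
    refine (Equiv.toPEquiv_trans (ketEquiv X.wires).symm (ketEquiv X.wires)).symm.trans ?_
    exact congrArg Equiv.toPEquiv (Equiv.symm_trans_self (ketEquiv X.wires))

/-- The functor obtained from `H₀` by restricting its codomain to `FPinj2`, with the total points
of `n` identified with the bit-strings of length `n`. -/
noncomputable def H0tilde : TOF ⥤ FPinj2 where
  obj X := X.wires
  map {X Y} f := InducedCategory.homMk ((ketIso X).hom ≫ H0.map f ≫ (ketIso Y).inv)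
  map_id X := by
    apply InducedCategory.hom_ext
    rw [H0.map_id, Category.id_comp, Iso.hom_inv_id]; rfl
  map_comp f g := by
    apply InducedCategory.hom_ext
    simp

/-! ### Circuits in polynomial form -/

namespace Circ

/-- The `not` gate controlled by `n` wires, `cnot n : n + 1 → n + 1`: the control wires are the
first `n` wires and the target wire is the last one. -/
def cnotN : (n : ℕ) → Circ (n + 1) (n + 1)
  | 0 => not
  | 1 => cnot
  | 2 => tof
  | j + 3 =>
    cast (by omega) (by omega)
      ((id 2 ⊠ ketZero ⊠ id (j + 2)) ⨾ (tof ⊠ id (j + 2)) ⨾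
        cast (n' := 3 + (j + 2)) (m' := 3 + (j + 2)) (by omega) (by omega)
          (id 2 ⊠ cnotN (j + 2)) ⨾
        (tof ⊠ id (j + 2)) ⨾ (id 2 ⊠ braZero ⊠ id (j + 2)))

/-- Circuits which only permute wires. -/
inductive IsPermutation : {n m : ℕ} → Circ n m → Prop
  | id (n : ℕ) : IsPermutation (id n)
  | symm (n m : ℕ) : IsPermutation (symm n m)
  | comp {n m k : ℕ} {f : Circ n m} {g : Circ m k} :
      IsPermutation f → IsPermutation g → IsPermutation (f ⨾ g)
  | tensor {n m n' m' : ℕ} {f : Circ n m} {g : Circ n' m'} :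
      IsPermutation f → IsPermutation g → IsPermutation (f ⊠ g)

/-- Circuits in polynomial form on `n + 1` wires: composites of controlled `not` gates whose
controls are among the first `n` wires and whose target is the last wire. A gate with `j` controls
and `k` unused wires is written by permuting the first `n = k + j` wires so that the controls come
directly above the target, and permuting back afterwards. -/
inductive IsPolynomialForm : (n : ℕ) → Circ (n + 1) (n + 1) → Prop
  | id (n : ℕ) : IsPolynomialForm n (id (n + 1))
  | gate (k j : ℕ) (π : Circ (k + j) (k + j)) (hπ : IsPermutation π) :
      IsPolynomialForm (k + j) ((π ⊠ id 1) ⨾ (id k ⊠ cnotN j) ⨾ (dag π ⊠ id 1))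
  | comp {n : ℕ} {f g : Circ (n + 1) (n + 1)} :
      IsPolynomialForm n f → IsPolynomialForm n g → IsPolynomialForm n (f ⨾ g)

/-- Circuits `n → n + m` obtained by iteratively adjoining a last wire in state `|0⟩` and applying
to the first `n` wires and this new wire a circuit in polynomial form. -/
inductive IsPolynomialSimulation (n : ℕ) : (m : ℕ) → Circ n (n + m) → Prop
  | zero : IsPolynomialSimulation n 0 (id n)
  | succ {m : ℕ} {p : Circ n (n + m)} {q : Circ (n + 1) (n + 1)} :
      IsPolynomialSimulation n m p → IsPolynomialForm n q →
      IsPolynomialSimulation n (m + 1) ((id n ⊠ ketZero) ⨾ q ⨾ (p ⊠ id 1))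

end Circ

/-- A circuit from `n` to `m`, as a map of `TOF`. -/
def Circ.toHom {n m : ℕ} (c : Circ n m) : (⟨n⟩ : TOF) ⟶ ⟨m⟩ := Mor.mk c

/-- The partial isomorphism of sets of bit-strings given by a map of `TOF` under `H0tilde`. -/
noncomputable def onBits {n m : ℕ} (f : (⟨n⟩ : TOF) ⟶ ⟨m⟩) :
    (Fin n → ZMod 2) ≃. (Fin m → ZMod 2) :=
  (H0tilde.map f).hom

end Toffoli

/-!
A polynomial function over `ZMod 2` is a sum of products of distinct bits, because `x ^ e = x` for
`e ≠ 0`, and every function of finitely many bits is polynomial. Adding one such product to the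
target wire is a single generalized `cnot` gate whose controls have been moved next to the target,
and composing gates adds the functions they contribute. Computing the output bits one by one onto
fresh `|0⟩` wires gives `b ↦ (b, f b)`.

For a partial isomorphism `g`, compute `b ↦ (b, g b)` together with a bit recording whether `g b`
is defined, and post-select that bit with `⟨1|`. Doing the same for the inverse of `g` gives a
circuit `d ↦ (d, g⁻¹ d)`, whose horizontal flip erases the input from `(g b, b)` and leaves `g b`.
-/

namespace Toffoli

open MvPolynomial in
theorem closure_range_prod_eq_top (σ : Type*) [Finite σ] :
    AddSubmonoid.closure
      (Set.range fun (s : Finset σ) (b : σ → ZMod 2) => ∏ i ∈ s, b i) = ⊤ := by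
  refine eq_top_iff.mpr fun g _ => ?_
  obtain ⟨P, rfl⟩ : ∃ P : MvPolynomial σ (ZMod 2), (fun b => eval b P) = g := by
    have hg : g ∈ (restrictDegree σ (ZMod 2) (Fintype.card (ZMod 2) - 1)).map
        (evalₗ (ZMod 2) σ) := by
      rw [map_restrict_dom_evalₗ]
      trivial
    obtain ⟨P, -, hP⟩ := hg
    exact ⟨P, hP⟩
  have pow_eq_self (x : ZMod 2) {e : ℕ} (he : e ≠ 0) : x ^ e = x := by
    have hx : IsIdempotentElem x := (by decide : ∀ x : ZMod 2, x * x = x) x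
    obtain ⟨e, rfl⟩ := Nat.exists_eq_succ_of_ne_zero he
    exact hx.pow_succ_eq e
  have coeff_eq_one {d : σ →₀ ℕ} (hd : d ∈ P.support) : P.coeff d = 1 :=
    (by decide : ∀ c : ZMod 2, c ≠ 0 → c = 1) _ (mem_support_iff.mp hd)
  have eval_eq_sum : (fun b => eval b P) = ∑ d ∈ P.support, fun b => ∏ i ∈ d.support, b i := by
    funext b
    rw [eval_eq, Finset.sum_apply]
    refine Finset.sum_congr rfl fun d hd => ?_
    rw [coeff_eq_one hd, one_mul]
    exact Finset.prod_congr rfl fun i hi => pow_eq_self (b i) (Finsupp.mem_support_iff.mp hi)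
  rw [eval_eq_sum]
  exact sum_mem fun d _ => AddSubmonoid.subset_closure ⟨d.support, rfl⟩

namespace Circ

theorem eval_comp_eq_some {n m k : ℕ} {f : Circ n m} {g : Circ m k} {l a r : List (ZMod 2)}
    (hf : f.eval l = some a) (hg : g.eval a = some r) : (f ⨾ g).eval l = some r := by
  rw [eval, hf, Option.bind_some, hg]

theorem eval_tensor_append {n m n' m' : ℕ} (f : Circ n m) (g : Circ n' m')
    {l : List (ZMod 2)} (hl : l.length = n) (l' : List (ZMod 2)) :
    (f ⊠ g).eval (l ++ l') = (f.eval l).bind fun a => (g.eval l').map (a ++ ·) := by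
  subst hl
  simp [eval, Option.map_eq_bind]

theorem eval_tensor_id_append {n m : ℕ} (f : Circ n m) (k : ℕ)
    {l : List (ZMod 2)} (hl : l.length = n) (l' : List (ZMod 2)) :
    (f ⊠ id k).eval (l ++ l') = (f.eval l).map (· ++ l') := by
  rw [eval_tensor_append f (id k) hl]
  cases f.eval l <;> rfl

theorem eval_id_tensor_append {n m k : ℕ} (g : Circ n m)
    {l : List (ZMod 2)} (hl : l.length = k) (l' : List (ZMod 2)) :
    (id k ⊠ g).eval (l ++ l') = (g.eval l').map (l ++ ·) :=
  eval_tensor_append (id k) g hl l'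

theorem eval_symm_append {n m : ℕ} {l : List (ZMod 2)} (hl : l.length = n) (l' : List (ZMod 2)) :
    (symm n m).eval (l ++ l') = some (l' ++ l) := by
  subst hl
  simp [eval]

theorem eval_dag {n m : ℕ} (f : Circ n m) {l r : List (ZMod 2)} (hl : l.length = n)
    (h : f.eval l = some r) : f.dag.eval r = some l := by
  induction f generalizing l r with
  | id n => simpa only [eval, dag, Option.some.injEq, eq_comm] using h
  | comp f g hf hg =>
    obtain ⟨a, ha, hr⟩ := Option.bind_eq_some_iff.mp h
    exact eval_comp_eq_some (hg (eval_length f _ _ hl ha) hr) (hf hl ha)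
  | @tensor n _ n' _ f g hf hg =>
    have hl₁ : (l.take n).length = n := by simp [hl]
    have hl₂ : (l.drop n).length = n' := by rw [List.length_drop, hl, Nat.add_sub_cancel_left]
    obtain ⟨a, ha, b, hb, rfl⟩ : ∃ a, f.eval (l.take n) = some a ∧
        ∃ b, g.eval (l.drop n) = some b ∧ a ++ b = r := by
      simpa only [eval, Option.bind_eq_some_iff, Option.some.injEq] using h
    rw [dag, eval_tensor_append _ _ (eval_length f _ _ hl₁ ha), hf hl₁ ha, hg hl₂ hb]
    exact congrArg some (List.take_append_drop n l)
  | symm n m =>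
    obtain rfl : l.drop n ++ l.take n = r := Option.some.inj h
    rw [dag, eval_symm_append (by simp [hl]), List.take_append_drop]
  | ketOne =>
    obtain rfl := List.length_eq_zero_iff.mp hl
    obtain rfl : [1] = r := Option.some.inj h
    rfl
  | braOne =>
    obtain ⟨rfl, rfl⟩ : l = [1] ∧ [] = r := by
      simpa only [eval, Option.ite_none_right_eq_some, Option.some.injEq] using h
    rfl
  | tof =>
    obtain ⟨a, b, c, rfl⟩ := List.length_eq_three.mp hl
    obtain rfl : [a, b, a * b + c] = r := Option.some.inj h
    simp only [dag, eval, ← add_assoc, CharTwo.add_self_eq_zero, zero_add]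

theorem eval_id_tensor_ketZero {n : ℕ} {l : List (ZMod 2)} (hl : l.length = n) :
    (id n ⊠ ketZero).eval l = some (l ++ [0]) := by
  have eval_ketZero : ketZero.eval [] = some [0] := by decide
  simpa only [List.append_nil, eval_ketZero, Option.map_some] using
    eval_id_tensor_append ketZero hl []

theorem eval_id_tensor_braZero {n : ℕ} {l : List (ZMod 2)} (hl : l.length = n) :
    (id n ⊠ braZero).eval (l ++ [0]) = some l := by
  have eval_braZero : braZero.eval [0] = some [] := by decide
  rw [eval_id_tensor_append braZero hl, eval_braZero, Option.map_some, List.append_nil]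

theorem eval_id_tensor_braOne {n : ℕ} {l : List (ZMod 2)} (hl : l.length = n) (t : ZMod 2) :
    (id n ⊠ braOne).eval (l ++ [t]) = if t = 1 then some l else none := by
  rw [eval_id_tensor_append braOne hl]
  by_cases ht : t = 1 <;> simp [eval, ht]

theorem eval_id_tensor_ketZero_tensor_id {n : ℕ} {l : List (ZMod 2)} (hl : l.length = n)
    (k : ℕ) (r : List (ZMod 2)) :
    (id n ⊠ ketZero ⊠ id k).eval (l ++ r) = some (l ++ [0] ++ r) := by
  refine (eval_tensor_id_append (id n ⊠ ketZero) k hl r).trans ?_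
  rw [eval_id_tensor_ketZero hl, Option.map_some]

theorem eval_id_tensor_braZero_tensor_id {n : ℕ} {l : List (ZMod 2)} (hl : l.length = n)
    (k : ℕ) (r : List (ZMod 2)) :
    (id n ⊠ braZero ⊠ id k).eval (l ++ [0] ++ r) = some (l ++ r) := by
  rw [eval_tensor_id_append _ k (by simp [hl]), eval_id_tensor_braZero hl, Option.map_some]

theorem eval_tof_tensor_id (a b c : ZMod 2) (k : ℕ) (r : List (ZMod 2)) :
    (tof ⊠ id k).eval (a :: b :: c :: r) = some (a :: b :: (a * b + c) :: r) :=
  eval_tensor_id_append tof k (l := [a, b, c]) rfl r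

theorem eval_cnotN {n : ℕ} {l : List (ZMod 2)} (hl : l.length = n) (t : ZMod 2) :
    (cnotN n).eval (l ++ [t]) = some (l ++ [l.prod + t]) := by
  match n, l with
  | 0, [] => revert t; decide
  | 1, [a] => revert a t; decide
  | 2, [a, b] => revert a b t; decide
  | j + 3, a :: b :: l =>
    have hl' : (a * b :: l).length = j + 2 := by simpa using hl
    have prepare : (id 2 ⊠ ketZero ⊠ id (j + 2)).eval (a :: b :: (l ++ [t])) =
        some (a :: b :: 0 :: (l ++ [t])) :=
      eval_id_tensor_ketZero_tensor_id (l := [a, b]) rfl (j + 2) _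
    have compute : (tof ⊠ id (j + 2)).eval (a :: b :: 0 :: (l ++ [t])) =
        some (a :: b :: a * b :: (l ++ [t])) := by
      rw [eval_tof_tensor_id, add_zero]
    have apply_cnotN : (id 2 ⊠ cnotN (j + 2)).eval (a :: b :: a * b :: (l ++ [t])) =
        some (a :: b :: a * b :: (l ++ [a * b * l.prod + t])) := by
      refine (eval_id_tensor_append (k := 2) (l := [a, b]) _ rfl _).trans ?_
      rw [← List.cons_append, eval_cnotN hl', List.prod_cons]
      rfl
    have uncompute (t' : ZMod 2) : (tof ⊠ id (j + 2)).eval (a :: b :: a * b :: (l ++ [t'])) =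
        some (a :: b :: 0 :: (l ++ [t'])) := by
      rw [eval_tof_tensor_id, CharTwo.add_self_eq_zero]
    have discard (t' : ZMod 2) :
        (id 2 ⊠ braZero ⊠ id (j + 2)).eval (a :: b :: 0 :: (l ++ [t'])) =
          some (a :: b :: (l ++ [t'])) :=
      eval_id_tensor_braZero_tensor_id (l := [a, b]) rfl (j + 2) _
    rw [cnotN, eval_cast, List.prod_cons, List.prod_cons, ← mul_assoc]
    exact eval_comp_eq_some (eval_comp_eq_some (eval_comp_eq_some (eval_comp_eq_some prepare
      compute) ((congrFun (eval_cast _ _ _) _).trans apply_cnotN)) (uncompute _)) (discard _)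

/-- The circuit moving the last of `k + j + 1` wires above the `j` wires that precede it. -/
def moveLast (k j : ℕ) : Circ (k + j + 1) (k + j + 1) :=
  cast (Nat.add_assoc k j 1).symm (by omega : k + (1 + j) = k + j + 1) (id k ⊠ symm j 1)

theorem IsPermutation.cast {n m n' m' : ℕ} {f : Circ n m} (hf : IsPermutation f) (hn : n = n')
    (hm : m = m') : IsPermutation (f.cast hn hm) := by
  subst hn hm
  exact hf

theorem isPermutation_moveLast (k j : ℕ) : IsPermutation (moveLast k j) :=
  ((IsPermutation.id k).tensor (.symm j 1)).cast _ _

theorem eval_moveLast {k j : ℕ} {u v : List (ZMod 2)} (hu : u.length = k) (hv : v.length = j)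
    (x : ZMod 2) : (moveLast k j).eval (u ++ v ++ [x]) = some (u ++ [x] ++ v) := by
  rw [moveLast, eval_cast, List.append_assoc, List.append_assoc, eval_id_tensor_append _ hu,
    eval_symm_append hv, Option.map_some]

theorem filter_finRange_succ_last {n : ℕ} (p : Fin (n + 1) → Bool) :
    (List.finRange (n + 1)).filter p =
      ((List.finRange n).filter fun i => p i.castSucc).map Fin.castSucc ++
        if p (Fin.last n) then [Fin.last n] else [] := by
  rw [List.finRange_succ_last, List.filter_append, List.filter_map, List.filter_singleton]
  simp only [Function.comp_def, Bool.cond_eq_ite]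

theorem length_filter_not_add_length_filter_finRange {n : ℕ} (p : Fin n → Bool) :
    ((List.finRange n).filter (!p ·)).length + ((List.finRange n).filter p).length = n := by
  rw [add_comm, ← List.length_eq_length_filter_add, List.length_finRange]

theorem exists_isPermutation_eval_partition {n : ℕ} (p : Fin n → Bool) :
    ∃ π : Circ n n, IsPermutation π ∧ ∀ b : Fin n → ZMod 2,
      π.eval (List.ofFn b) =
        some (((List.finRange n).filter (!p ·)).map b ++ ((List.finRange n).filter p).map b) := by
  induction n with
  | zero => exact ⟨id 0, .id 0, fun b => rfl⟩
  | succ n ih =>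
    obtain ⟨π, hπ, eval_π⟩ := ih fun i => p i.castSucc
    have eval_π_tensor (b : Fin (n + 1) → ZMod 2) :=
      (eval_tensor_id_append π 1 (List.length_ofFn (f := fun i => b i.castSucc))
        [b (Fin.last n)]).trans (congrArg _ (eval_π _))
    simp only [← List.ofFn_succ_last, Option.map_some] at eval_π_tensor
    simp only [filter_finRange_succ_last]
    cases hp : p (Fin.last n) with
    | true =>
      refine ⟨π ⊠ id 1, hπ.tensor (.id 1), fun b => (eval_π_tensor b).trans ?_⟩
      simp [Function.comp_def]
    | false =>
      obtain ⟨k, j, hk, hj, rfl⟩ : ∃ k j,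
          ((List.finRange n).filter fun i => !p i.castSucc).length = k ∧
            ((List.finRange n).filter fun i => p i.castSucc).length = j ∧ k + j = n :=
        ⟨_, _, rfl, rfl, length_filter_not_add_length_filter_finRange _⟩
      refine ⟨(π ⊠ id 1) ⨾ moveLast k j, (hπ.tensor (.id 1)).comp (isPermutation_moveLast k j),
        fun b => (eval_comp_eq_some (eval_π_tensor b) (eval_moveLast ?_ ?_ _)).trans ?_⟩
      · rw [List.length_map, hk]
      · rw [List.length_map, hj]
      · simp [Function.comp_def]

/-- The circuit `q` computes `g` reversibly: it fixes the first `n` bits and adds the value of `g`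
at them to the last bit. -/
def IsOracle {n : ℕ} (q : Circ (n + 1) (n + 1)) (g : (Fin n → ZMod 2) → ZMod 2) : Prop :=
  ∀ (b : Fin n → ZMod 2) (t : ZMod 2),
    q.eval (List.ofFn b ++ [t]) = some (List.ofFn b ++ [g b + t])

theorem isOracle_id (n : ℕ) : (id (n + 1)).IsOracle (0 : (Fin n → ZMod 2) → ZMod 2) :=
  fun b t => by
  rw [Pi.zero_apply, zero_add, eval]

theorem IsOracle.comp {n : ℕ} {q q' : Circ (n + 1) (n + 1)} {g g' : (Fin n → ZMod 2) → ZMod 2}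
    (hq : q.IsOracle g) (hq' : q'.IsOracle g') : (q ⨾ q').IsOracle (g + g') := fun b t => by
  rw [Pi.add_apply, add_comm (g b), add_assoc]
  exact eval_comp_eq_some (hq b t) (hq' b _)

theorem prod_map_filter_finRange {M : Type*} [CommMonoid M] {n : ℕ} (s : Finset (Fin n))
    (b : Fin n → M) : (((List.finRange n).filter (· ∈ s)).map b).prod = ∏ i ∈ s, b i := by
  rw [← List.prod_toFinset b ((List.nodup_finRange n).filter _)]
  congr
  ext i
  simp

theorem exists_isPolynomialForm_isOracle_prod {n : ℕ} (s : Finset (Fin n)) :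
    ∃ q, IsPolynomialForm n q ∧ q.IsOracle fun b => ∏ i ∈ s, b i := by
  obtain ⟨π, hπ, eval_π⟩ := exists_isPermutation_eval_partition (· ∈ s)
  obtain ⟨k, j, hk, hj, rfl⟩ : ∃ k j,
      ((List.finRange n).filter fun i => !decide (i ∈ s)).length = k ∧
        ((List.finRange n).filter (· ∈ s)).length = j ∧ k + j = n :=
    ⟨_, _, rfl, rfl, length_filter_not_add_length_filter_finRange _⟩
  refine ⟨_, .gate k j π hπ, fun b t => ?_⟩
  set u := ((List.finRange (k + j)).filter fun i => !decide (i ∈ s)).map b with hu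
  set v := ((List.finRange (k + j)).filter (· ∈ s)).map b with hv
  have u_length : u.length = k := by rw [hu, List.length_map, hk]
  have v_length : v.length = j := by rw [hv, List.length_map, hj]
  have v_prod : v.prod = ∏ i ∈ s, b i := prod_map_filter_finRange s b
  have permute : (π ⊠ id 1).eval (List.ofFn b ++ [t]) = some (u ++ v ++ [t]) := by
    rw [eval_tensor_id_append π 1 List.length_ofFn, eval_π b, Option.map_some]
  have apply_cnotN : (id k ⊠ cnotN j).eval (u ++ v ++ [t]) =
      some (u ++ v ++ [∏ i ∈ s, b i + t]) := by
    rw [List.append_assoc, List.append_assoc, eval_id_tensor_append _ u_length,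
      eval_cnotN v_length, Option.map_some, v_prod]
  have unpermute (t' : ZMod 2) : (dag π ⊠ id 1).eval (u ++ v ++ [t']) =
      some (List.ofFn b ++ [t']) := by
    rw [eval_tensor_id_append _ 1 (by simp [u_length, v_length]),
      eval_dag π List.length_ofFn (eval_π b), Option.map_some]
  exact eval_comp_eq_some (eval_comp_eq_some permute apply_cnotN) (unpermute _)

theorem exists_isPolynomialForm_isOracle {n : ℕ} (g : (Fin n → ZMod 2) → ZMod 2) :
    ∃ q, IsPolynomialForm n q ∧ q.IsOracle g := by
  have hg : g ∈ AddSubmonoid.closure _ :=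
    (closure_range_prod_eq_top (Fin n)).ge (AddSubmonoid.mem_top g)
  induction hg using AddSubmonoid.closure_induction with
  | mem g hg =>
    obtain ⟨s, rfl⟩ := hg
    exact exists_isPolynomialForm_isOracle_prod s
  | zero => exact ⟨id (n + 1), .id n, isOracle_id n⟩
  | add g g' _ _ hg hg' =>
    obtain ⟨q, hq, hqg⟩ := hg
    obtain ⟨q', hq', hqg'⟩ := hg'
    exact ⟨q ⨾ q', hq.comp hq', hqg.comp hqg'⟩

theorem exists_isPolynomialSimulation {n m : ℕ} (f : (Fin n → ZMod 2) → Fin m → ZMod 2) :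
    ∃ c, IsPolynomialSimulation n m c ∧ ∀ b : Fin n → ZMod 2,
      c.eval (List.ofFn b) = some (List.ofFn b ++ List.ofFn (f b)) := by
  induction m with
  | zero => exact ⟨id n, .zero, fun b => by rw [List.ofFn_zero, List.append_nil, eval]⟩
  | succ m ih =>
    obtain ⟨p, hp, eval_p⟩ := ih fun b i => f b i.castSucc
    obtain ⟨q, hq, hqf⟩ := exists_isPolynomialForm_isOracle fun b => f b (Fin.last m)
    refine ⟨_, hp.succ hq, fun b => ?_⟩
    have eval_q := hqf b 0
    rw [add_zero] at eval_q
    have eval_p_tensor : (p ⊠ id 1).eval (List.ofFn b ++ [f b (Fin.last m)]) =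
        some (List.ofFn b ++ List.ofFn (f b)) := by
      rw [eval_tensor_id_append p 1 List.length_ofFn, eval_p, Option.map_some,
        List.ofFn_succ_last (f := f b), List.append_assoc]
    exact eval_comp_eq_some (eval_comp_eq_some (eval_id_tensor_ketZero List.length_ofFn) eval_q)
      eval_p_tensor

theorem exists_eval_eq_map_append {n m : ℕ}
    (g : (Fin n → ZMod 2) → Option (Fin m → ZMod 2)) :
    ∃ c : Circ n (n + m), ∀ b : Fin n → ZMod 2,
      c.eval (List.ofFn b) = (g b).map fun d => List.ofFn b ++ List.ofFn d := by
  obtain ⟨p, -, eval_p⟩ := exists_isPolynomialSimulation fun b =>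
    (Fin.snoc ((g b).getD 0) (if (g b).isSome then 1 else 0) : Fin (m + 1) → ZMod 2)
  refine ⟨p ⨾ (id (n + m) ⊠ braOne), fun b => ?_⟩
  rw [eval, eval_p, Option.bind_some, List.ofFn_succ_last, ← List.append_assoc,
    eval_id_tensor_braOne (by simp)]
  cases g b <;> simp

theorem exists_eval_eq_map_ofFn {n m : ℕ} (g : (Fin n → ZMod 2) ≃. (Fin m → ZMod 2)) :
    ∃ c : Circ n m, ∀ b : Fin n → ZMod 2, c.eval (List.ofFn b) = (g b).map List.ofFn := by
  obtain ⟨p, eval_p⟩ := exists_eval_eq_map_append g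
  obtain ⟨q, eval_q⟩ := exists_eval_eq_map_append g.symm
  refine ⟨p ⨾ symm n m ⨾ q.dag, fun b => ?_⟩
  cases hb : g b with
  | none => simp [eval, eval_p, hb]
  | some d =>
    have hd : g.symm d = some b := g.mem_iff_mem.mpr hb
    have eval_p_b : p.eval (List.ofFn b) = some (List.ofFn b ++ List.ofFn d) := by
      rw [eval_p, hb, Option.map_some]
    have eval_q_d : q.eval (List.ofFn d) = some (List.ofFn d ++ List.ofFn b) := by
      rw [eval_q, hd, Option.map_some]
    exact eval_comp_eq_some (eval_comp_eq_some eval_p_b (eval_symm_append List.length_ofFn _))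
      (eval_dag q List.length_ofFn eval_q_d)

theorem eval_nil_eq_some_ofFn_iff {n : ℕ} (c : Circ 0 n) (b : Fin n → ZMod 2) :
    c.eval [] = some (List.ofFn b) ↔ Mor.mk c = Mor.ket n b := by
  have eval_of_mk_eq {e : Fin n → ZMod 2} (h : Mor.mk c = Mor.ket n e) :
      c.eval [] = some (List.ofFn e) :=
    (Mor.eval_mk_eq (h.trans (Mor.mk_ketCirc n e).symm) [] rfl).trans (Mor.eval_ketCirc n e)
  refine ⟨fun h => ?_, eval_of_mk_eq⟩
  rcases Mor.good (Mor.mk c) with ⟨e, he⟩ | hω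
  · rw [he, List.ofFn_injective (Option.some.inj (h.symm.trans (eval_of_mk_eq he)))]
  · have eval_eq_none : c.eval [] = none :=
      (Mor.eval_mk_eq (hω.trans (Mor.mk_omegaCirc n).symm) [] rfl).trans (Mor.eval_omegaCirc n)
    simp [h] at eval_eq_none

theorem eval_ofFn_eq_some_ofFn_iff {n m : ℕ} (c : Circ n m) (b : Fin n → ZMod 2)
    (d : Fin m → ZMod 2) :
    c.eval (List.ofFn b) = some (List.ofFn d) ↔
      Mor.comp (Mor.ket n b) (Mor.mk c) = Mor.ket m d := by
  rw [← Mor.mk_ketCirc n b, ← Mor.mk_comp, ← eval_nil_eq_some_ofFn_iff, eval, Mor.eval_ketCirc,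
    Option.bind_some]

end Circ

theorem onBits_eq_some_iff {n m : ℕ} (f : Mor n m) (b : Fin n → ZMod 2) (d : Fin m → ZMod 2) :
    onBits f b = some d ↔ Mor.comp (Mor.ket n b) f = Mor.ket m d := by
  refine Iff.trans ?_ (onPoints_eq_some_iff f (ketEquiv n b) (ketEquiv m d))
  change ((ketEquiv n).toPEquiv.trans ((onPoints f).trans (ketEquiv m).symm.toPEquiv)) b =
    some d ↔ _
  simp only [PEquiv.trans_eq_some, Equiv.toPEquiv_apply, Option.some.injEq, exists_eq_left',
    Equiv.symm_apply_eq, exists_eq_right]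

theorem onBits_toHom_eq_some_iff {n m : ℕ} (c : Circ n m) (b : Fin n → ZMod 2)
    (d : Fin m → ZMod 2) :
    onBits c.toHom b = some d ↔ c.eval (List.ofFn b) = some (List.ofFn d) :=
  (onBits_eq_some_iff (Mor.mk c) b d).trans (c.eval_ofFn_eq_some_ofFn_iff b d).symm

theorem H0tilde_full : H0tilde.Full where
  map_surjective {X Y} g := by
    obtain ⟨c, eval_c⟩ := Circ.exists_eval_eq_map_ofFn (n := X.wires) (m := Y.wires) g.hom
    have onBits_c : onBits c.toHom = g.hom := PEquiv.ext fun b => Option.ext fun d => by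
      refine (onBits_toHom_eq_some_iff c b d).trans ?_
      rw [eval_c, ← Option.map_some, (Option.map_injective List.ofFn_injective).eq_iff]
    exact ⟨c.toHom, CategoryTheory.InducedCategory.hom_ext onBits_c⟩

end Toffoli

theorem mainTheorem5 :
    Toffoli.H0tilde.Full ∧
      ∀ (n m : ℕ) (f : (Fin n → ZMod 2) → (Fin m → ZMod 2)),
        ∃ c : Toffoli.Circ n (n + m), Toffoli.Circ.IsPolynomialSimulation n m c ∧
          ∀ b : Fin n → ZMod 2,
            Toffoli.onBits c.toHom b = some (Fin.append b (f b)) := by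
  refine ⟨Toffoli.H0tilde_full, fun n m f => ?_⟩
  obtain ⟨c, hc, eval_c⟩ := Toffoli.Circ.exists_isPolynomialSimulation f
  refine ⟨c, hc, fun b => ?_⟩
  rw [Toffoli.onBits_toHom_eq_some_iff, eval_c, List.ofFn_fin_append]
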